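/- Fix a prime number $p$, and let $G$ be a group of inertia type, i.e. a finite group having a normal $p$-subgroup $H$ such that $G/H$ is cyclic of order prime to $p$. Let $\ell\neq p$ be a prime number. Let $K$ be a complete discrete valuation field of characteristic $0$ and residue characteristic $\ell$, with valuation ring $\mathcal{O}_K$ and valuation $v$ normalized so that $v(K^\times)=\mathbf{Z}$, and let $e=v(\ell)$ be its absolute ramification degree. Let $V$ be a $K$-vector space of dimension $2d$ with a $K$-linear action of $G$, and suppose that $V$ is a symplectic $K[G]$-module, i.e. that there is a nondegenerate alternating $G$-invariant $K$-bilinear form $V\times V\to K$. Suppose that $\ell>de+1$. Then there exist a $G$-stable $\mathcal{O}_K$-lattice $T$ in $V$ (a finitely generated $\mathcal{O}_K$-submodule spanning $V$ over $K$) and a perfect alternating $G$-invariant $\mathcal{O}_K$-bilinear form $$f' : T\times T\to\mathcal{O}_K,$$ where perfect means that both natural maps $T\to\mathrm{Hom}_{\mathcal{O}_K}(T,\mathcal{O}_K)$ are bijective. In matrix terms: for every $K$-basis of $V$, the image of $G$ in $\mathrm{GL}_{2d}(K)$ is conjugate in $\mathrm{GL}_{2d}(K)$ to a subgroup of $\mathrm{Sp}_{2d}(\mathcal{O}_K)$.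 -/

import Mathlib

/-- `G` is a group of inertia type with respect to the prime `p`: it is finite and has a normal
`p`-subgroup `H` such that `G ⧸ H` is cyclic of order prime to `p`. -/
def IsOfInertiaType (p : ℕ) (G : Type*) [Group G] : Prop :=
  Finite G ∧ ∃ (H : Subgroup G) (_ : H.Normal),
    IsPGroup p H ∧ IsCyclic (G ⧸ H) ∧ (Nat.card (G ⧸ H)).Coprime p

/-- `V` (with the action `ρ`) is a symplectic `K[G]`-module: it carries a nondegenerate alternating
`G`-invariant `K`-bilinear form. -/
def Representation.IsSymplectic {K G V : Type*} [Field K] [Group G] [AddCommGroup V] [Module K V]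
    (ρ : Representation K G V) : Prop :=
  ∃ f : LinearMap.BilinForm K V, f.Nondegenerate ∧ f.IsAlt ∧
    ∀ (g : G) (x y : V), f (ρ g x) (ρ g y) = f x y

/-! Let T be a G-stable lattice on which an invariant symplectic form f is integral, and let L be
its dual; the quotient L/T measures how far T is from self-dual. With n = dim V, the hypothesis is
used only as ne < 2(ℓ - 1). This passes to subspaces, so orthogonal splitting reduces to V with no
proper nonzero nondegenerate subrepresentation.

Among the pairs (π^i f, T), choose one for which L/T has least length r. Then T is maximal, πL ⊆ T
and 2r ≤ n (`exists_minimal_isIntegralLattice`), hence r < ℓ - 1. Suppose r ≠ 0, and let σ be the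
ℓ-part of a lift of a generator of G/H. A Hall-Higman type argument
(`commute_of_mem_normalizer_of_isPGroup`) shows that σ commutes with H on L/T. The elements of H
trivial on L/T are trivial on V, because their fixed vectors form a nonzero nondegenerate
subrepresentation (`eq_one_of_trivial_on_quotient`). Hence ρ(σ) is central in ρ(G).

If ρ(σ) = 1, then ρ(G) has order prime to ℓ. Averaging splits L/πL into T/πL and L/T, and combining
f on the first with πf on the second gives a form for which L is self-dual
(`hasSelfDualLattice_of_isUnit_card`).

If ρ(σ) ≠ 1, some power τ of σ has central image of order ℓ, without nonzero fixed vectors by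
indecomposability. Maximality of T gives (τ - 1)L ⊆ T (`sub_mem_of_central`). Since ℓL ⊆ (τ -
1)^(ℓ-1) L, it follows that (ℓ - 1)r ≤ length(L/ℓL) = ne. The form is alternating, so r = 1 is
impossible (`two_le_relLength_dualSubmodule`); thus 2(ℓ - 1) ≤ ne, a contradiction. -/

open Module
open scoped commutatorElement

/-! ### Irreducible representations of groups with central commutators -/

section Burnside

variable {E W : Type*} [Field E] [IsAlgClosed E] [AddCommGroup W] [Module E W]
  [FiniteDimensional E W]

/-- Burnside's theorem on irreducible algebras of endomorphisms. -/
theorem Subalgebra.eq_top_of_isSimpleModule (A : Subalgebra E (Module.End E W))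
    [IsSimpleModule A W] : A = ⊤ := by
  rw [eq_top_iff]
  rintro f -
  classical
  have hs := (IsSimpleModule.algebraMap_end_bijective_of_isAlgClosed (A := A) (V := W) E).2
  -- By Schur's lemma the commutant of A consists of scalars, so f is linear over it and the density
  -- theorem applies.
  let F : Module.End (Module.End A W) W :=
    { toFun := f
      map_add' := f.map_add
      map_smul' := fun c x => by
        obtain ⟨t, rfl⟩ := hs c
        simp }
  let b := Module.finBasis E W
  obtain ⟨a, ha⟩ := jacobson_density F (Finset.univ.image b)
  have : f = a := b.ext fun i => by
    exact ha (b i) (by simp)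
  rw [this]
  exact a.2

/-- The operators of an irreducible representation span the endomorphism algebra. -/
theorem Representation.span_range_eq_top_of_irreducible {P : Type*} [Group P] [Nontrivial W]
    (θ : P →* Module.End E W)
    (hirr : ∀ U : Submodule E W, (∀ x, U ≤ U.comap (θ x)) → U = ⊥ ∨ U = ⊤) :
    Submodule.span E (Set.range θ) = ⊤ := by
  let A := Algebra.adjoin E (Set.range θ)
  have : IsSimpleModule A W := by
    refine { exists_pair_ne := ⟨⊥, ⊤, bot_ne_top⟩, eq_bot_or_eq_top := fun U => ?_ }
    rcases hirr (U.restrictScalars E) (fun x w hw => by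
      have := U.smul_mem (⟨θ x, Algebra.subset_adjoin ⟨x, rfl⟩⟩ : A) hw
      exact this) with h | h
    · left; simpa using h
    · right; simpa using h
  have h := Subalgebra.eq_top_of_isSimpleModule A
  have h2 := Algebra.adjoin_eq_span E (Set.range θ)
  have h3 : (Submonoid.closure (Set.range θ) : Set (Module.End E W)) = Set.range θ := by
    rw [← MonoidHom.coe_mrange, Submonoid.closure_eq]
  rw [h3] at h2
  rw [← h2]
  change Subalgebra.toSubmodule A = ⊤
  rw [h]; simp

/-- If `θ` is irreducible, commutators are central and every element acting centrally is central,
then the operators of `θ` form a basis modulo the center. -/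
theorem Representation.card_quotient_center_eq_finrank_sq {P : Type*} [Group P] [Finite P]
    [Nontrivial W] (θ : P →* Module.End E W)
    (hirr : ∀ U : Submodule E W, (∀ x, U ≤ U.comap (θ x)) → U = ⊥ ∨ U = ⊤)
    (hcomm : ∀ x y : P, ⁅x, y⁆ ∈ Subgroup.center P)
    (hrad : ∀ x, (∀ y, Commute (θ x) (θ y)) → x ∈ Subgroup.center P) :
    Nat.card (P ⧸ Subgroup.center P) = finrank E W ^ 2 := by
  have hspan := Representation.span_range_eq_top_of_irreducible θ hirr
  have hunit : ∀ x, θ x * θ x⁻¹ = 1 := fun x => by rw [← map_mul]; simp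
  have hunit' : ∀ x, θ x⁻¹ * θ x = 1 := fun x => by rw [← map_mul]; simp
  have hne : ∀ x, θ x ≠ 0 := fun x h => by
    have := hunit x
    rw [h, zero_mul] at this
    exact zero_ne_one this
  -- an endomorphism commuting with all operators is a scalar
  have hscal : ∀ z ∈ Subgroup.center P, ∃ c : E, θ z = c • 1 := by
    intro z hz
    have hc : ∀ f : Module.End E W, Commute (θ z) f := by
      intro f
      have hf : f ∈ Submodule.span E (Set.range θ) := hspan ▸ Submodule.mem_top
      induction hf using Submodule.span_induction with
      | mem f hf =>
        obtain ⟨x, rfl⟩ := hf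
        rw [Commute, SemiconjBy, ← map_mul, ← map_mul, Subgroup.mem_center_iff.1 hz x]
      | zero => exact Commute.zero_right _
      | add f g _ _ h1 h2 => exact h1.add_right h2
      | smul c f _ h => exact h.smul_right c
    obtain ⟨c, _, hc'⟩ := (Module.End.mem_center_iff (f := θ z)).1
      (Subring.mem_center_iff.2 fun g => (hc g).symm.eq)
    exact ⟨c, by ext w; simp [hc']⟩
  choose! c hc using hscal
  have hconj : ∀ x y, θ y * θ x * θ y⁻¹ = c ⁅y, x⁆ • θ x := fun x y => by
    rw [← map_mul, ← map_mul, show y * x * y⁻¹ = ⁅y, x⁆ * x by simp [commutatorElement_def],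
      map_mul, hc _ (hcomm y x), smul_mul_assoc, one_mul]
  -- P acts on End W by conjugation, and each θ x is a simultaneous eigenvector with weight y ↦ c
  -- ⁅y, x⁆. Distinct cosets of the center have distinct weights, which gives linear independence of
  -- coset representatives.
  let C : P → Module.End E (Module.End E W) := fun y => LinearMap.mulLeftRight E (θ y, θ y⁻¹)
  have hC : ∀ y f, C y f = θ y * f * θ y⁻¹ := fun y f => by simp [C]
  have hCcomm : ∀ y y', Commute (C y) (C y') := by
    intro y y'
    ext1 f
    have hf : f ∈ Submodule.span E (Set.range θ) := hspan ▸ Submodule.mem_top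
    induction hf using Submodule.span_induction with
    | mem f hf =>
      obtain ⟨x, rfl⟩ := hf
      simp only [Module.End.mul_apply, hC, hconj, mul_smul_comm, smul_mul_assoc]
      rw [smul_comm]
    | zero => simp
    | add f g _ _ h1 h2 => rw [map_add, map_add, h1, h2]
    | smul c f _ h => rw [map_smul, map_smul, h]
  have hind := Module.End.independent_iInf_maxGenEigenspace_of_forall_mapsTo C
    (fun i j φ => Module.End.mapsTo_maxGenEigenspace_of_comm (hCcomm j i) φ)
  let wt : P ⧸ Subgroup.center P → P → E := fun q y => c ⁅y, q.out⁆
  have hwt : Function.Injective wt := by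
    intro q q' h
    -- If two representatives have equal weights, the operator of their quotient commutes with every
    -- θ y, and `hrad` applies.
    have hmem : (q.out)⁻¹ * q'.out ∈ Subgroup.center P := by
      apply hrad
      intro y
      have h1 := hconj q.out y
      have h2 := hconj q'.out y
      have h3 : c ⁅y, q.out⁆ = c ⁅y, q'.out⁆ := congrFun h y
      have key : θ y * (θ q.out⁻¹ * θ q'.out) * θ y⁻¹ = θ q.out⁻¹ * θ q'.out := by
        have hcne : c ⁅y, q.out⁆ ≠ 0 := fun h0 => by
          have := hc _ (hcomm y q.out)
          rw [h0, zero_smul] at this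
          exact hne _ this
        have e1 : θ q.out * (θ y * (θ q.out⁻¹ * θ q'.out) * θ y⁻¹) = θ q'.out := by
          have : c ⁅y, q.out⁆ • (θ q.out * (θ y * (θ q.out⁻¹ * θ q'.out) * θ y⁻¹))
              = c ⁅y, q.out⁆ • θ q'.out := by
            rw [← smul_mul_assoc, ← h1, h3, ← h2]
            simp only [← map_mul]
            congr 1
            group
          exact smul_right_injective _ hcne this
        calc _ = θ q.out⁻¹ * (θ q.out * (θ y * (θ q.out⁻¹ * θ q'.out) * θ y⁻¹)) := by
              rw [← mul_assoc (θ q.out⁻¹), hunit', one_mul]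
          _ = _ := by rw [e1]
      rw [map_mul, Commute, SemiconjBy]
      nth_rewrite 1 [← key]
      rw [mul_assoc _ (θ y⁻¹), hunit', mul_one]
    have := QuotientGroup.eq.2 hmem
    rwa [QuotientGroup.out_eq', QuotientGroup.out_eq'] at this
  let u : P ⧸ Subgroup.center P → Module.End E W := fun q => θ q.out
  have hli : LinearIndependent E u := by
    refine (hind.comp hwt).linearIndependent _ (fun q => ?_) (fun q => hne _)
    simp only [Function.comp, Submodule.mem_iInf]
    intro y
    refine Module.End.mem_maxGenEigenspace _ _ _ |>.2 ⟨1, ?_⟩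
    simp only [pow_one, LinearMap.sub_apply, hC, u, wt, hconj]
    simp
  have hsp : ⊤ ≤ Submodule.span E (Set.range u) := by
    rw [← hspan, Submodule.span_le]
    rintro _ ⟨x, rfl⟩
    let q : P ⧸ Subgroup.center P := x
    have hz : x * (q.out)⁻¹ ∈ Subgroup.center P := by
      have h1 : (q.out)⁻¹ * x ∈ Subgroup.center P := QuotientGroup.eq.1 (by simp [q])
      have := Subgroup.Normal.conj_mem inferInstance _ h1 q.out
      simpa [mul_assoc] using this
    have : θ x = c (x * (q.out)⁻¹) • u q := by
      have e := hc _ hz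
      calc θ x = θ (x * (q.out)⁻¹) * θ q.out := by rw [← map_mul]; simp
        _ = _ := by rw [e, smul_mul_assoc, one_mul]
    rw [this]
    exact Submodule.smul_mem _ _ (Submodule.subset_span ⟨q, rfl⟩)
  rw [← Module.finrank_eq_nat_card_basis (Basis.mk hli hsp), Module.finrank_linearMap, sq]

end Burnside

/-! ### Weight spaces of finite abelian linear groups -/

section Weights

variable {E M : Type*} [Field E] [AddCommGroup M] [Module E M]

/-- Endomorphisms of finite order invertible in the field are semisimple. -/
theorem Module.End.maxGenEigenspace_eq_eigenspace_of_pow_eq_one {f : Module.End E M} {N : ℕ}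
    (hN : (N : E) ≠ 0) (hf : f ^ N = 1) (μ : E) :
    f.maxGenEigenspace μ = f.eigenspace μ := by
  refine Module.End.IsFinitelySemisimple.maxGenEigenspace_eq_eigenspace ?_ μ
  refine Module.End.IsSemisimple.isFinitelySemisimple ?_
  refine Module.End.isSemisimple_of_squarefree_aeval_eq_zero
    (p := Polynomial.X ^ N - 1) (Polynomial.Separable.squarefree ?_) (by simp [hf])
  exact Polynomial.X_pow_sub_one_separable_iff.2 hN

/-- The simultaneous eigenspaces of a subgroup of the general linear group. -/
def weightSpace (A : Subgroup (Module.End E M)ˣ) (χ : A → E) : Submodule E M :=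
  ⨅ a : A, Module.End.eigenspace (a.1.1) (χ a)

theorem mem_weightSpace {A : Subgroup (Module.End E M)ˣ} {χ : A → E} {v : M} :
    v ∈ weightSpace A χ ↔ ∀ a : A, (a.1.1 : Module.End E M) v = χ a • v := by
  simp [weightSpace]

variable {A : Subgroup (Module.End E M)ˣ} {N : ℕ}

theorem weightSpace_eq (hN : (N : E) ≠ 0) (hAN : ∀ x ∈ A, x ^ N = 1) :
    weightSpace A = fun χ : A → E => ⨅ a : A, Module.End.maxGenEigenspace (a.1.1) (χ a) := by
  funext χ
  refine iInf_congr fun a => (Module.End.maxGenEigenspace_eq_eigenspace_of_pow_eq_one hN ?_ _).symm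
  simpa [Units.ext_iff] using hAN a.1 a.2

theorem iSupIndep_weightSpace (hA : ∀ x ∈ A, ∀ y ∈ A, x * y = y * x)
    (hN : (N : E) ≠ 0) (hAN : ∀ x ∈ A, x ^ N = 1) :
    iSupIndep (weightSpace A) := by
  rw [weightSpace_eq hN hAN]
  refine Module.End.independent_iInf_maxGenEigenspace_of_forall_mapsTo
    (fun a : A => (a.1.1 : Module.End E M))
    (fun a b φ => Module.End.mapsTo_maxGenEigenspace_of_comm ?_ φ)
  exact congrArg Units.val (hA b.1 b.2 a.1 a.2)

variable [FiniteDimensional E M]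

theorem iSup_weightSpace_eq_top [IsAlgClosed E] (hA : ∀ x ∈ A, ∀ y ∈ A, x * y = y * x)
    (hN : (N : E) ≠ 0) (hAN : ∀ x ∈ A, x ^ N = 1) :
    ⨆ χ, weightSpace A χ = ⊤ := by
  rw [weightSpace_eq hN hAN]
  refine Module.End.iSup_iInf_maxGenEigenspace_eq_top_of_iSup_maxGenEigenspace_eq_top_of_commute
    _ (fun a b _ => ?_) (fun a => Module.End.iSup_maxGenEigenspace_eq_top _)
  exact congrArg Units.val (hA a.1 a.2 b.1 b.2)

/-- Two endomorphisms agreeing on all weight spaces are equal. -/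
theorem eq_of_eqOn_weightSpace [IsAlgClosed E] (hA : ∀ x ∈ A, ∀ y ∈ A, x * y = y * x)
    (hN : (N : E) ≠ 0) (hAN : ∀ x ∈ A, x ^ N = 1) {f g : Module.End E M}
    (h : ∀ χ, ∀ v ∈ weightSpace A χ, f v = g v) : f = g := by
  have : ⨆ χ, weightSpace A χ ≤ LinearMap.eqLocus f g := iSup_le fun χ v hv => h χ v hv
  rw [iSup_weightSpace_eq_top hA hN hAN] at this
  ext v
  exact this Submodule.mem_top

/-- An element of `ℓ`-power order normalizing an abelian linear group of degree less than `ℓ`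
centralizes it. -/
theorem commute_of_mem_normalizer_of_abelian [IsAlgClosed E] (hA : ∀ x ∈ A, ∀ y ∈ A, x * y = y * x)
    (hN : (N : E) ≠ 0) (hAN : ∀ x ∈ A, x ^ N = 1) {ℓ s : ℕ} (hℓ : ℓ.Prime)
    (hdim : finrank E M < ℓ) {σ : (Module.End E M)ˣ} (hσ : σ ^ ℓ ^ s = 1)
    (hσA : σ ∈ Subgroup.normalizer (A : Set (Module.End E M)ˣ)) : ∀ x ∈ A, σ * x = x * σ := by
  classical
  have hind := iSupIndep_weightSpace hA hN hAN
  let φ : MulAut A := A.normalizerMonoidHom ⟨σ, hσA⟩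
  have hφ : ∀ a : A, (φ a : (Module.End E M)ˣ) = σ * a * σ⁻¹ := fun a => rfl
  have hφpow : φ ^ ℓ ^ s = 1 := by
    rw [← map_pow]
    convert map_one A.normalizerMonoidHom
    exact Subtype.ext hσ
  let Φ : (A → E) ≃ (A → E) := (Equiv.arrowCongr φ.toEquiv (Equiv.refl E))
  have hΦ : ∀ χ a, Φ χ (φ a) = χ a := fun χ a => by simp [Φ]
  have hΦpow : ∀ (k : ℕ) χ a, (Φ ^ k) χ ((φ ^ k) a) = χ a := by
    intro k
    induction k with
    | zero => intro χ a; rfl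
    | succ k ih =>
      intro χ a
      rw [pow_succ', pow_succ']
      exact (hΦ _ _).trans (ih χ a)
  have hmap : ∀ χ v, v ∈ weightSpace A χ → (σ : Module.End E M) v ∈ weightSpace A (Φ χ) := by
    intro χ v hv
    rw [mem_weightSpace] at hv ⊢
    intro a
    obtain ⟨b, rfl⟩ := φ.surjective a
    rw [hΦ, ← map_smul, ← hv b, hφ]
    simp only [Units.val_mul, Module.End.mul_apply]
    rw [← Module.End.mul_apply, ← Module.End.mul_apply (↑σ⁻¹ : Module.End E M)]
    simp
  -- σ permutes the weights that occur. There are fewer than ℓ of them, so a permutation of ℓ-power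
  -- order is trivial. Then x and its conjugate by σ act by the same scalar on every weight space.
  let X := {χ : A → E // weightSpace A χ ≠ ⊥}
  have : Fintype X := hind.fintypeNeBotOfFiniteDimensional
  have hcard : Fintype.card X < ℓ := lt_of_le_of_lt hind.subtype_ne_bot_le_finrank hdim
  have hmapX : ∀ χ, weightSpace A χ ≠ ⊥ → weightSpace A (Φ χ) ≠ ⊥ := by
    intro χ h
    obtain ⟨v, hv, hv0⟩ := Submodule.exists_mem_ne_zero_of_ne_bot h
    refine fun h0 => hv0 ?_
    have := hmap χ v hv
    rw [h0, Submodule.mem_bot] at this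
    have h2 : (↑σ⁻¹ : Module.End E M) ((σ : Module.End E M) v) = 0 := by rw [this, map_zero]
    rwa [← Module.End.mul_apply, ← Units.val_mul, inv_mul_cancel] at h2
  let f : X → X := fun χ => ⟨Φ χ.1, hmapX χ.1 χ.2⟩
  have hf : Function.Injective f := fun χ χ' h => Subtype.ext (Φ.injective (congrArg Subtype.val h))
  let F : Equiv.Perm X := Equiv.ofBijective f (Finite.injective_iff_bijective.1 hf)
  have hFpow : F ^ ℓ ^ s = 1 := by
    have : ∀ (k : ℕ) (χ : X), ((F ^ k) χ).1 = (Φ ^ k) χ.1 := by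
      intro k
      induction k with
      | zero => intro χ; rfl
      | succ k ih => intro χ; rw [pow_succ', pow_succ', Equiv.Perm.mul_apply, Equiv.Perm.mul_apply,
                       ← ih]; rfl
    ext χ a
    rw [this]
    have := hΦpow (ℓ ^ s) χ.1 a
    rw [hφpow] at this
    exact this
  have hF1 : F = 1 := by
    have h1 : orderOf F ∣ ℓ ^ s := orderOf_dvd_of_pow_eq_one hFpow
    obtain ⟨k, -, hk⟩ := (Nat.dvd_prime_pow hℓ).1 h1
    have h2 : orderOf F ∣ (Fintype.card X).factorial := by
      rw [← Fintype.card_perm]; exact orderOf_dvd_card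
    rcases Nat.eq_zero_or_pos k with rfl | hk0
    · rwa [pow_zero, orderOf_eq_one_iff] at hk
    · have : ℓ ∣ (Fintype.card X).factorial :=
        (dvd_pow_self ℓ hk0.ne').trans (hk ▸ h2)
      exact absurd ((hℓ.dvd_factorial).1 this) (not_le.2 hcard)
  intro x hx
  have key : ((φ ⟨x, hx⟩ : (Module.End E M)ˣ) : Module.End E M) = x := by
    refine eq_of_eqOn_weightSpace hA hN hAN fun χ v hv => ?_
    by_cases hχ : weightSpace A χ = ⊥
    · rw [hχ, Submodule.mem_bot] at hv
      rw [hv, map_zero, map_zero]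
    · have h1 : Φ χ = χ := congrArg Subtype.val (Equiv.Perm.ext_iff.1 hF1 ⟨χ, hχ⟩)
      have h2 := hΦ χ ⟨x, hx⟩
      rw [h1] at h2
      rw [mem_weightSpace] at hv
      rw [hv (φ ⟨x, hx⟩), h2, ← hv ⟨x, hx⟩]
  have h3 : σ * x * σ⁻¹ = x := by
    rw [← hφ ⟨x, hx⟩]; exact Units.ext key
  rwa [mul_inv_eq_iff_eq_mul] at h3

end Weights

/-! ### A Hall-Higman type theorem in dimension less than ℓ - 1 -/

section HallHigman

/-- Coprime action: if `σ` has `ℓ`-power order, `z` commutes with `σ`, has `p`-power order and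
`σ x σ⁻¹ = x z`, then `z = 1`. -/
theorem eq_one_of_conj_eq_mul {Γ : Type*} [Group Γ] {σ x z : Γ} {a b : ℕ} (hab : a.Coprime b)
    (hσ : σ ^ a = 1) (hz : z ^ b = 1) (hσz : σ * z = z * σ) (h : σ * x * σ⁻¹ = x * z) : z = 1 := by
  have key : ∀ k : ℕ, σ ^ k * x * (σ ^ k)⁻¹ = x * z ^ k := by
    intro k
    induction k with
    | zero => simp
    | succ k ih =>
      have hc : σ * z ^ k * σ⁻¹ = z ^ k := by
        rw [(show Commute σ z from hσz).pow_right k |>.eq, mul_inv_cancel_right]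
      calc σ ^ (k + 1) * x * (σ ^ (k + 1))⁻¹ = σ * (σ ^ k * x * (σ ^ k)⁻¹) * σ⁻¹ := by
            rw [pow_succ']; group
        _ = (σ * x * σ⁻¹) * (σ * z ^ k * σ⁻¹) := by rw [ih]; group
        _ = x * z ^ (k + 1) := by rw [h, hc, pow_succ', mul_assoc]
  have h1 := key a
  rw [hσ] at h1
  have h2 : z ^ a = 1 := by simpa using h1
  have h3 : orderOf z ∣ 1 := by
    rw [← hab]
    exact Nat.dvd_gcd (orderOf_dvd_of_pow_eq_one h2) (orderOf_dvd_of_pow_eq_one hz)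
  exact orderOf_eq_one_iff.1 (Nat.dvd_one.1 h3)

variable {E M : Type*} [Field E] [IsAlgClosed E] [AddCommGroup M] [Module E M]
  [FiniteDimensional E M]

/-- An element of `ℓ`-power order normalizing a `p`-group of linear maps in dimension less than
`ℓ - 1` centralizes it. -/
theorem commute_of_mem_normalizer_of_isPGroup {p ℓ s : ℕ} (hp : p.Prime) (hℓ : ℓ.Prime)
    (hpℓ : ℓ ≠ p) (hpE : (p : E) ≠ 0) (hdim : finrank E M + 1 < ℓ) {σ : (Module.End E M)ˣ}
    (hσ : σ ^ ℓ ^ s = 1) (P : Subgroup (Module.End E M)ˣ) [Finite P] (hP : IsPGroup p P)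
    (hσP : σ ∈ Subgroup.normalizer (P : Set (Module.End E M)ˣ)) : ∀ x ∈ P, σ * x = x * σ := by
  classical
  -- A minimal counterexample P has central commutators and σ centralizes its center Z. Counting
  -- fixed points of σ on P/Z, whose order is the square of the dimension of an irreducible
  -- constituent, gives the contradiction.
  induction hn : Nat.card P using Nat.strong_induction_on generalizing P with
  | _ n ih =>
  subst hn
  have : Fact p.Prime := ⟨hp⟩
  obtain ⟨a, ha⟩ := IsPGroup.iff_card.1 hP
  have hpow : ∀ x ∈ P, x ^ p ^ a = 1 := fun x hx => by
    have := pow_card_eq_one' (x := (⟨x, hx⟩ : P))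
    rw [ha] at this
    simpa [Subtype.ext_iff] using this
  have hpaE : ((p ^ a : ℕ) : E) ≠ 0 := by push_cast; exact pow_ne_zero _ hpE
  have hcop : (ℓ ^ s).Coprime (p ^ a) :=
    Nat.Coprime.pow _ _ ((Nat.coprime_primes hℓ hp).2 hpℓ)
  rw [Subgroup.mem_normalizer_iff] at hσP
  by_contra! hcon
  obtain ⟨x₀, hx₀, hx₀σ⟩ := hcon
  -- Finite order of σ turns stability under conjugation by σ into the equivalence required by the
  -- normalizer: σ⁻¹ is a nonnegative power of σ.
  have hiff : ∀ Q : Subgroup (Module.End E M)ˣ, (∀ x ∈ Q, σ * x * σ⁻¹ ∈ Q) →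
      ∀ x, x ∈ Q ↔ σ * x * σ⁻¹ ∈ Q := by
    intro Q hQ x
    refine ⟨hQ x, fun hx => ?_⟩
    have hk : ∀ k : ℕ, ∀ y ∈ Q, σ ^ k * y * (σ ^ k)⁻¹ ∈ Q := by
      intro k
      induction k with
      | zero => intro y hy; simpa using hy
      | succ k ih =>
        intro y hy
        have := hQ _ (ih y hy)
        rw [pow_succ']
        convert this using 1
        group
    have := hk (ℓ ^ s - 1) _ hx
    have e : σ ^ (ℓ ^ s - 1) * σ = 1 := by
      rw [← pow_succ, Nat.sub_add_cancel (Nat.one_le_pow _ _ hℓ.pos), hσ]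
    convert this using 1
    calc x = (σ ^ (ℓ ^ s - 1) * σ) * x * (σ ^ (ℓ ^ s - 1) * σ)⁻¹ := by rw [e]; simp
      _ = _ := by group
  -- proper invariant subgroups are centralized
  have fact1 : ∀ Q : Subgroup (Module.End E M)ˣ, Q < P → (∀ x ∈ Q, σ * x * σ⁻¹ ∈ Q) →
      ∀ x ∈ Q, σ * x = x * σ := by
    intro Q hQ hσQ
    have : Finite Q := Finite.of_injective _ (Subgroup.inclusion_injective hQ.le)
    have hlt : Nat.card Q < Nat.card P := Set.ncard_lt_ncard hQ (Set.toFinite (P : Set (Module.End E M)ˣ))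
    exact ih _ hlt Q (hP.to_le hQ.le)
      (Subgroup.mem_normalizer_iff.2 (hiff Q hσQ)) rfl
  -- proper normal invariant subgroups are central
  have fact2 : ∀ Q : Subgroup (Module.End E M)ˣ, Q < P → (∀ x ∈ Q, σ * x * σ⁻¹ ∈ Q) →
      (∀ x ∈ P, ∀ q ∈ Q, x * q * x⁻¹ ∈ Q) → ∀ x ∈ P, ∀ q ∈ Q, q * x = x * q := by
    intro Q hQ hσQ hQn
    have hQc := fact1 Q hQ hσQ
    -- If D is proper, σ centralizes D by minimality. As σ centralizes the normal subgroup Q, every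
    -- x⁻¹(σxσ⁻¹) with x ∈ P also centralizes Q, so it lies in D, and coprimality makes it trivial.
    -- Then σ would centralize P.
    let D := P ⊓ Subgroup.centralizer (Q : Set (Module.End E M)ˣ)
    by_cases hD : D = P
    · intro x hx q hq
      have : x ∈ D := hD ▸ hx
      exact Subgroup.mem_centralizer_iff.1 this.2 q hq
    · exfalso
      have hDlt : D < P := lt_of_le_of_ne inf_le_left hD
      have hDc := fact1 D hDlt fun x hx => by
        refine ⟨(hσP x).1 hx.1, ?_⟩
        have h := hx.2
        simp only [Subgroup.coe_toSubmonoid, SetLike.mem_coe, Subgroup.mem_centralizer_iff] at h ⊢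
        intro q hq
        have h1 := hQc q hq
        have h2 : σ⁻¹ * q = q * σ⁻¹ := by
          rw [inv_mul_eq_iff_eq_mul, ← mul_assoc, h1, mul_inv_cancel_right]
        calc q * (σ * x * σ⁻¹) = (q * σ) * x * σ⁻¹ := by group
          _ = σ * (q * x) * σ⁻¹ := by rw [← h1]; group
          _ = σ * x * (q * σ⁻¹) := by rw [h q hq]; group
          _ = _ := by rw [← h2]; group
      apply hx₀σ
      let z := x₀⁻¹ * (σ * x₀ * σ⁻¹)
      have hzP : z ∈ P := P.mul_mem (P.inv_mem hx₀) ((hσP x₀).1 hx₀)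
      have hzD : z ∈ D := by
        refine ⟨hzP, ?_⟩
        simp only [Subgroup.coe_toSubmonoid, SetLike.mem_coe, Subgroup.mem_centralizer_iff]
        intro q hq
        have h1 := hQc q hq
        have h2 := hQc _ (hQn x₀ hx₀ q hq)
        have h4 : σ⁻¹ * q = q * σ⁻¹ := by
            rw [inv_mul_eq_iff_eq_mul, ← mul_assoc, h1, mul_inv_cancel_right]
        calc q * z = x₀⁻¹ * ((x₀ * q * x₀⁻¹) * σ) * x₀ * σ⁻¹ := by simp only [z]; group
          _ = x₀⁻¹ * σ * x₀ * (q * σ⁻¹) := by rw [← h2]; group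
          _ = z * q := by rw [← h4]; simp only [z]; group
      have hz1 : z = 1 := eq_one_of_conj_eq_mul hcop hσ (hpow z hzP) (hDc z hzD)
        (x := x₀) (by simp only [z]; group)
      have : σ * x₀ * σ⁻¹ = x₀ := by
        have := congrArg (x₀ * ·) hz1
        simpa [z] using this
      rwa [mul_inv_eq_iff_eq_mul] at this
  -- the center
  let Z := P ⊓ Subgroup.centralizer (P : Set (Module.End E M)ˣ)
  have hZmem : ∀ z, z ∈ Z ↔ z ∈ P ∧ ∀ x ∈ P, x * z = z * x := fun z => by
    simp only [Z, Subgroup.mem_inf, Subgroup.mem_centralizer_iff, SetLike.mem_coe]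
  have hZlt : Z < P := by
    refine lt_of_le_of_ne inf_le_left fun h => hx₀σ ?_
    refine commute_of_mem_normalizer_of_abelian (A := P) (fun x hx y hy => ?_) hpaE hpow hℓ
      (by omega) hσ (Subgroup.mem_normalizer_iff.2 hσP) x₀ hx₀
    rw [← h] at hy
    exact ((hZmem y).1 hy).2 x hx
  have hZσ : ∀ z ∈ Z, σ * z = z * σ := fact1 Z hZlt fun z hz => by
    rw [hZmem] at hz ⊢
    refine ⟨(hσP z).1 hz.1, fun x hx => ?_⟩
    have hx' : σ⁻¹ * x * σ ∈ P := by
      rw [hσP]; convert hx using 1; group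
    have := hz.2 _ hx'
    calc x * (σ * z * σ⁻¹) = σ * ((σ⁻¹ * x * σ) * z) * σ⁻¹ := by group
      _ = _ := by rw [this]; group
  have hZP : ∀ z ∈ Z, z ∈ P := fun z hz => ((hZmem z).1 hz).1
  -- commutators are central
  have hcommZ : ∀ x ∈ P, ∀ y ∈ P, ⁅x, y⁆ ∈ Z := by
    -- The derived subgroup is proper because a p-group is nilpotent; `fact2` then makes it central.
    have hDP : ⁅P, P⁆ < P := by
      refine lt_of_le_of_ne (Subgroup.commutator_le_self P) fun h => ?_
      have : Nontrivial P := by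
        rw [Subgroup.nontrivial_iff_exists_ne_one]
        refine ⟨x₀, hx₀, fun h1 => hx₀σ (by simp [h1])⟩
      have : Group.IsNilpotent P := hP.isNilpotent
      have h1 : commutator P < ⊤ := Group.IsSolvable.commutator_lt_top_of_nontrivial P
      refine h1.ne ?_
      apply Subgroup.map_injective P.subtype_injective
      rw [Subgroup.map_subtype_commutator, h, ← MonoidHom.range_eq_map, Subgroup.range_subtype]
    have := fact2 ⁅P, P⁆ hDP (fun x hx => by
      have h1 : ⁅P, P⁆.map (MulAut.conj σ).toMonoidHom ≤ ⁅P, P⁆ := by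
        rw [Subgroup.map_commutator]
        have : P.map (MulAut.conj σ).toMonoidHom ≤ P := by
          rintro _ ⟨y, hy, rfl⟩
          exact (hσP y).1 hy
        exact Subgroup.commutator_mono this this
      exact h1 ⟨x, hx, rfl⟩) (fun x hx q hq => by
      have h1 : ⁅x, q⁆ ∈ ⁅P, P⁆ := Subgroup.commutator_mem_commutator hx (hDP.le hq)
      have h2 : x * q * x⁻¹ = ⁅x, q⁆ * q := by simp [commutatorElement_def]
      rw [h2]
      exact mul_mem h1 hq)
    intro x hx y hy
    have hm : ⁅x, y⁆ ∈ ⁅P, P⁆ := Subgroup.commutator_mem_commutator hx hy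
    exact (hZmem _).2 ⟨hDP.le hm, fun w hw => (this w hw _ hm).symm⟩
  -- subgroups containing the center are normal
  have hnorm : ∀ Q : Subgroup (Module.End E M)ˣ, Q ≤ P → Z ≤ Q →
      ∀ x ∈ P, ∀ q ∈ Q, x * q * x⁻¹ ∈ Q := by
    intro Q hQP hZQ x hx q hq
    have h2 : x * q * x⁻¹ = ⁅x, q⁆ * q := by simp [commutatorElement_def]
    rw [h2]
    exact mul_mem (hZQ (hcommZ x hx q (hQP hq))) hq
  obtain ⟨x₁, hx₁, hx₁Z⟩ := SetLike.exists_of_lt hZlt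
  obtain ⟨y₁, hy₁, hxy⟩ : ∃ y₁ ∈ P, y₁ * x₁ ≠ x₁ * y₁ := by
    by_contra! h
    exact hx₁Z ((hZmem x₁).2 ⟨hx₁, h⟩)
  have hZcomm : ∀ x ∈ Z, ∀ y ∈ Z, x * y = y * x := fun x hx y hy =>
    ((hZmem y).1 hy).2 x (hZP x hx)
  have hZpow : ∀ x ∈ Z, x ^ p ^ a = 1 := fun x hx => hpow x (hZP x hx)
  -- The weight spaces of Z span, so a nontrivial commutator moves a vector in one of them. On that
  -- space W, the group P does not act through an abelian quotient.
  obtain ⟨χ, v₁, hv₁, hcv₁⟩ : ∃ χ, ∃ v ∈ weightSpace Z χ, ⁅x₁, y₁⁆ • v ≠ v := by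
    by_contra! h
    have := eq_of_eqOn_weightSpace hZcomm hpaE hZpow (f := (⁅x₁, y₁⁆ : (Module.End E M)ˣ).1)
      (g := 1) h
    have h1 : ⁅x₁, y₁⁆ = 1 := Units.ext this
    exact hxy (commutatorElement_eq_one_iff_mul_comm.1 h1).symm
  let W := weightSpace Z χ
  have hW : ∀ v, v ∈ W ↔ ∀ z, (hz : z ∈ Z) → z • v = χ ⟨z, hz⟩ • v := fun v => by
    rw [mem_weightSpace]
    exact ⟨fun h z hz => h ⟨z, hz⟩, fun h z => h z.1 z.2⟩
  have hWstab : ∀ τ : (Module.End E M)ˣ, (∀ z ∈ Z, τ * z = z * τ) → ∀ v ∈ W, τ • v ∈ W := by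
    intro τ hτ v hv
    rw [hW] at hv ⊢
    intro z hz
    rw [smul_smul, ← hτ z hz, ← smul_smul, hv z hz]
    exact map_smul τ.1 _ _
  have hWP : ∀ x ∈ P, ∀ v ∈ W, x • v ∈ W := fun x hx =>
    hWstab x fun z hz => ((hZmem z).1 hz).2 x hx
  have hWσ : ∀ v ∈ W, σ • v ∈ W := hWstab σ hZσ
  have hWσ' : ∀ v ∈ W, σ⁻¹ • v ∈ W := hWstab σ⁻¹ fun z hz => by
    rw [inv_mul_eq_iff_eq_mul, ← mul_assoc, hZσ z hz, mul_inv_cancel_right]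
  -- elements commuting with `P` on `W`
  let Rad : Subgroup (Module.End E M)ˣ :=
    { carrier := {x | x ∈ P ∧ ∀ y ∈ P, ∀ w ∈ W, x • y • w = y • x • w}
      one_mem' := ⟨P.one_mem, by simp⟩
      mul_mem' := by
        rintro x x' ⟨hx, h⟩ ⟨hx', h'⟩
        refine ⟨P.mul_mem hx hx', fun y hy w hw => ?_⟩
        rw [mul_smul, mul_smul, h' y hy w hw, h y hy _ (hWP x' hx' w hw)]
      inv_mem' := by
        rintro x ⟨hx, h⟩
        refine ⟨P.inv_mem hx, fun y hy w hw => ?_⟩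
        have := h y hy _ (hWP _ (P.inv_mem hx) w hw)
        rw [smul_inv_smul] at this
        rw [← this, inv_smul_smul] }
  have hRadP : Rad ≤ P := fun x hx => hx.1
  have hRad : Rad < P := by
    refine lt_of_le_of_ne hRadP fun h => hcv₁ ?_
    have h1 : x₁ ∈ Rad := h ▸ hx₁
    have h2 := h1.2 y₁ hy₁ (x₁⁻¹ • y₁⁻¹ • v₁)
      (hWP _ (P.inv_mem hx₁) _ (hWP _ (P.inv_mem hy₁) _ hv₁))
    rw [smul_inv_smul, smul_inv_smul] at h2
    rw [commutatorElement_def, mul_smul, mul_smul, mul_smul, h2]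
  have hZRad : Z ≤ Rad := fun z hz => ⟨hZP z hz, fun y hy w _ => by
    rw [smul_smul, smul_smul, ((hZmem z).1 hz).2 y hy]⟩
  have hRadZ : ∀ x ∈ P, ∀ q ∈ Rad, q * x = x * q := by
    refine fact2 Rad hRad (fun x hx => ⟨(hσP x).1 hx.1, fun y hy w hw => ?_⟩)
      (hnorm Rad hRadP hZRad)
    have hy' : σ⁻¹ * y * σ ∈ P := by
      rw [hσP]; convert hy using 1; group
    have := hx.2 _ hy' _ (hWσ' w hw)
    have := congrArg (σ • ·) this
    simp only [smul_smul] at this ⊢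
    convert this using 2 <;> group
  -- an irreducible subspace
  obtain ⟨U, ⟨hU0, hUW, hUP⟩, hUmin⟩ := wellFounded_lt.has_min
    {U : Submodule E M | U ≠ ⊥ ∧ U ≤ W ∧ ∀ x ∈ P, ∀ u ∈ U, x • u ∈ U}
    ⟨W, fun h => hcv₁ (by
      have : v₁ = 0 := by simpa [W, h] using hv₁
      simp [this]), le_rfl, hWP⟩
  have : Nontrivial U := Submodule.nontrivial_iff_ne_bot.2 hU0
  let θ : P →* Module.End E U :=
    { toFun := fun x => (x.1.1).restrict fun u hu => hUP x.1 x.2 u hu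
      map_one' := rfl
      map_mul' := fun _ _ => rfl }
  have hθ : ∀ (x : P) (u : U), ((θ x u : U) : M) = x.1 • (u : M) := fun _ _ => rfl
  have hcenter : ∀ x : P, x ∈ Subgroup.center P ↔ x.1 ∈ Z := fun x => by
    rw [Subgroup.mem_center_iff, hZmem]
    exact ⟨fun h => ⟨x.2, fun y hy => congrArg Subtype.val (h ⟨y, hy⟩)⟩,
      fun h y => Subtype.ext (h.2 y.1 y.2)⟩
  have hcard := Representation.card_quotient_center_eq_finrank_sq θ
    (by
      intro U' hU'
      by_contra! hne
      refine hUmin (U'.map U.subtype) ⟨?_, ?_, ?_⟩ ?_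
      · exact fun h => hne.1 (Submodule.map_injective_of_injective U.injective_subtype
          (h.trans (Submodule.map_bot _).symm))
      · exact (Submodule.map_subtype_le U U').trans hUW
      · rintro x hx _ ⟨u, hu, rfl⟩
        exact ⟨θ ⟨x, hx⟩ u, hU' ⟨x, hx⟩ hu, rfl⟩
      · refine lt_of_le_of_ne (Submodule.map_subtype_le U U') fun h => hne.2 ?_
        apply Submodule.map_injective_of_injective U.injective_subtype
        rw [h, Submodule.map_top, Submodule.range_subtype])
    (fun x y => (hcenter _).2 (hcommZ x.1 x.2 y.1 y.2))
    (by
      intro x hx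
      rw [hcenter]
      obtain ⟨u, hu⟩ := exists_ne (0 : U)
      have hu' : (u : M) ≠ 0 := fun h => hu (Subtype.ext h)
      -- If x commutes with P on U, then χ ⁅x, y⁆ = 1. Since Z acts on all of W through χ, x
      -- commutes with P on W as well, which places it in the central subgroup `Rad`.
      have hxR : x.1 ∈ Rad := by
        refine ⟨x.2, fun y hy w hw => ?_⟩
        have hzZ := hcommZ x.1 x.2 y hy
        have h1 : ∀ u' : U, x.1 • y • (u' : M) = y • x.1 • (u' : M) := fun u' =>
          congrArg Subtype.val (LinearMap.congr_fun (hx ⟨y, hy⟩) u')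
        have h2 : ⁅x.1, y⁆ • (u : M) = u := by
          have := h1 (θ x⁻¹ (θ ⟨y, hy⟩⁻¹ u))
          simp only [hθ, Subgroup.coe_inv, smul_inv_smul] at this
          rw [commutatorElement_def, mul_smul, mul_smul, mul_smul, this]
        have h3 := (hW _).1 (hUW u.2) _ hzZ
        rw [h2] at h3
        have h4 : χ ⟨_, hzZ⟩ = 1 := by
          have : (χ ⟨_, hzZ⟩ - 1) • (u : M) = 0 := by rw [sub_smul, ← h3, one_smul, sub_self]
          exact sub_eq_zero.1 ((smul_eq_zero.1 this).resolve_right hu')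
        have h5 := (hW _).1 (hWP y hy _ (hWP x.1 x.2 w hw)) _ hzZ
        rw [h4, one_smul] at h5
        rw [← h5, smul_smul, smul_smul, smul_smul]
        congr 1
        rw [commutatorElement_def]; group
      exact (hZmem _).2 ⟨x.2, fun y hy => (hRadZ y hy _ hxR).symm⟩)
  -- fixed points of `σ` modulo the center
  let φ : MulAut P := P.normalizerMonoidHom ⟨σ, Subgroup.mem_normalizer_iff.2 hσP⟩
  have hφ : ∀ x : P, (φ x : (Module.End E M)ˣ) = σ * x * σ⁻¹ := fun _ => rfl
  have hφpow : φ ^ ℓ ^ s = 1 := by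
    rw [← map_pow]
    convert map_one P.normalizerMonoidHom
    exact Subtype.ext hσ
  let F : P ⧸ Subgroup.center P →* P ⧸ Subgroup.center P :=
    QuotientGroup.map _ _ φ.toMonoidHom fun z hz => by
      rw [Subgroup.mem_comap, hcenter]
      have := hZσ _ ((hcenter z).1 hz)
      change σ * z * σ⁻¹ ∈ Z
      rw [this, mul_inv_cancel_right]
      exact (hcenter z).1 hz
  have hF : ∀ x : P, F x = (φ x : P) := fun _ => rfl
  let f : Function.End (P ⧸ Subgroup.center P) := fun q => F q
  have hfk : ∀ (k : ℕ) (x : P), (f ^ k) x = ((φ ^ k) x : P) := by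
    intro k
    induction k with
    | zero => intro x; rfl
    | succ k ih =>
      intro x
      rw [pow_succ', pow_succ']
      change F ((f ^ k) x) = _
      rw [ih, hF]; rfl
  have hf1 : f ^ ℓ ^ s = 1 := by
    funext q
    induction q using QuotientGroup.induction_on with
    | H x => rw [hfk, hφpow]; rfl
  have : Fact ℓ.Prime := ⟨hℓ⟩
  have : Fintype (P ⧸ Subgroup.center P) := Fintype.ofFinite _
  have hmod := Equiv.Perm.card_fixedPoints_modEq hf1
  rw [← Nat.card_eq_fintype_card, ← Nat.card_eq_fintype_card] at hmod
  let C := P ⊓ Subgroup.centralizer {σ}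
  have hCmem : ∀ x, x ∈ C ↔ x ∈ P ∧ σ * x = x * σ := fun x => by
    simp [C, Subgroup.mem_inf, Subgroup.mem_centralizer_singleton_iff, eq_comm]
  have hClt : C < P := lt_of_le_of_ne inf_le_left fun h => by
    have : x₀ ∈ C := h ▸ hx₀
    exact hx₀σ ((hCmem x₀).1 this).2
  have hCZ := fact2 C hClt (fun x hx => by
    rw [((hCmem x).1 hx).2, mul_inv_cancel_right]; exact hx)
    (hnorm C inf_le_left fun z hz => (hCmem z).2 ⟨hZP z hz, hZσ z hz⟩)
  -- By coprimality, a fixed coset consists of elements fixed by σ. These lie in C, which is proper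
  -- and normal, hence central by `fact2`.
  have hfix : Nat.card (Function.fixedPoints f) = 1 := by
    rw [Nat.card_eq_one_iff_exists]
    refine ⟨⟨1, map_one F⟩, fun q => Subtype.ext ?_⟩
    obtain ⟨q, hq⟩ := q
    change q = 1
    induction q using QuotientGroup.induction_on with
    | H x =>
      have h1 : ((φ x : P) : P ⧸ Subgroup.center P) = x := hq
      have h2 : (x⁻¹ * φ x) ∈ Subgroup.center P := QuotientGroup.eq.1 h1.symm
      rw [hcenter] at h2
      have h3 : (x⁻¹ * φ x).1 = 1 := eq_one_of_conj_eq_mul hcop hσ (hZpow _ h2) (hZσ _ h2)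
        (x := x.1) (by rw [← hφ]; simp)
      have h4 : φ x = x := by
        have : x⁻¹ * φ x = 1 := Subtype.ext h3
        exact (inv_mul_eq_one.1 this).symm
      have h5 : σ * x = x.1 * σ := by
        have := congrArg Subtype.val h4
        rwa [hφ, mul_inv_eq_iff_eq_mul] at this
      rw [QuotientGroup.eq_one_iff, hcenter, hZmem]
      exact ⟨x.2, fun y hy => (hCZ y hy _ ((hCmem _).2 ⟨x.2, h5⟩)).symm⟩
  rw [hfix, hcard] at hmod
  have hr : finrank E U ≤ finrank E M := Submodule.finrank_le U
  have hr1 : finrank E U ≠ 1 := fun h => by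
    rw [h, one_pow, Nat.card_eq_one_iff_unique] at hcard
    have h1 : ((⟨x₁, hx₁⟩ : P) : P ⧸ Subgroup.center P) = 1 := hcard.1.elim _ _
    rw [QuotientGroup.eq_one_iff, hcenter] at h1
    exact hx₁Z h1
  have hr0 : 0 < finrank E U := Module.finrank_pos
  -- Now dim U squared is 1 modulo ℓ, so ℓ divides (dim U - 1)(dim U + 1) = r(r + 2). Both factors
  -- are positive and less than ℓ; the bound dim M + 1 < ℓ is needed for the second.
  obtain ⟨r, hrr⟩ : ∃ r, finrank E U = r + 1 := ⟨finrank E U - 1, by omega⟩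
  rw [hrr] at hmod hr hr1
  have hdvd : ℓ ∣ r * (r + 2) := by
    have := (Nat.modEq_iff_dvd' (by nlinarith)).1 hmod.symm
    convert this using 1
    rw [eq_comm, Nat.sub_eq_iff_eq_add (by nlinarith)]
    ring
  rcases hℓ.dvd_mul.1 hdvd with h | h
  · have := Nat.le_of_dvd (by omega) h
    omega
  · have := Nat.le_of_dvd (by omega) h
    omega

end HallHigman

/-- Version of `commute_of_mem_normalizer_of_isPGroup` for representations over any field. -/
theorem Representation.commute_of_isPGroup {F M G : Type*} [Field F] [AddCommGroup M] [Module F M]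
    [FiniteDimensional F M] [Group G] {p ℓ s : ℕ} (hp : p.Prime) (hℓ : ℓ.Prime)
    (hpℓ : ℓ ≠ p) (hpF : (p : F) ≠ 0) (hdim : finrank F M + 1 < ℓ) (θ : Representation F G M)
    (H : Subgroup G) [H.Normal] [Finite H] (hH : IsPGroup p H) {σ : G} (hσ : σ ^ ℓ ^ s = 1)
    {h : G} (hh : h ∈ H) : θ σ * θ h = θ h * θ σ := by
  classical
  let E := AlgebraicClosure F
  let n := finrank F M
  let b : Basis (Fin n) F M := Module.finBasis F M
  -- Passing to matrices over the algebraic closure is injective, so commutation can be tested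
  -- there.
  let Ψ : Module.End F M →* Module.End E (Fin n → E) :=
    ((Matrix.toLinAlgEquiv' (R := E) (n := Fin n)).toMulEquiv.toMonoidHom.comp
      ((algebraMap F E).mapMatrix (m := Fin n)).toMonoidHom).comp
      (LinearMap.toMatrixAlgEquiv b).toMulEquiv.toMonoidHom
  have hΨ : Function.Injective Ψ := by
    refine (Matrix.toLinAlgEquiv' (R := E) (n := Fin n)).injective.comp
      (Function.Injective.comp ?_ (LinearMap.toMatrixAlgEquiv b).injective)
    exact Matrix.map_injective (algebraMap F E).injective
  let Θ : G →* (Module.End E (Fin n → E))ˣ := (Ψ.comp θ).toHomUnits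
  have hΘ : ∀ g, ((Θ g : (Module.End E (Fin n → E))ˣ) : Module.End E (Fin n → E)) = Ψ (θ g) :=
    fun g => rfl
  have hpE : (p : E) ≠ 0 := by
    rw [← map_natCast (algebraMap F E)]
    exact fun h0 => hpF ((map_eq_zero _).1 h0)
  have : Finite (H.map Θ) := (Set.toFinite (H : Set G)).image Θ
  have key := commute_of_mem_normalizer_of_isPGroup (E := E) (M := Fin n → E) (σ := Θ σ)
    hp hℓ hpℓ hpE (by simpa [n] using hdim) (by rw [← map_pow, hσ, map_one]) (H.map Θ)
    (hH.map Θ) (by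
      rw [Subgroup.mem_normalizer_iff]
      intro x
      constructor
      · rintro ⟨y, hy, rfl⟩
        exact ⟨σ * y * σ⁻¹, Subgroup.Normal.conj_mem inferInstance y hy σ, by simp⟩
      · rintro ⟨y, hy, h⟩
        refine ⟨σ⁻¹ * y * σ, ?_, ?_⟩
        · have := Subgroup.Normal.conj_mem inferInstance y hy σ⁻¹
          simpa using this
        · rw [map_mul, map_mul, h, map_inv]; group) (Θ h) ⟨h, hh, rfl⟩
  apply hΨ
  rw [map_mul, map_mul, ← hΘ, ← hΘ, ← Units.val_mul, key, Units.val_mul]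

/-- Version of `commute_of_mem_normalizer_of_isPGroup` for modules over a local ring killed by the
maximal ideal. -/
theorem commute_of_isPGroup_of_length {R M G : Type*} [CommRing R] [IsLocalRing R]
    [AddCommGroup M] [Module R M] [Module.Finite R M] [Group G] {p ℓ s : ℕ} (hp : p.Prime)
    (hℓ : ℓ.Prime) (hpℓ : ℓ ≠ p) (hpR : IsUnit (p : R))
    (hM : ∀ r ∈ IsLocalRing.maximalIdeal R, ∀ x : M, r • x = 0)
    (hdim : Module.length R M + 1 < ℓ) (θ : G →* Module.End R M)
    (H : Subgroup G) [H.Normal] [Finite H] (hH : IsPGroup p H) {σ : G} (hσ : σ ^ ℓ ^ s = 1)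
    {h : G} (hh : h ∈ H) : θ σ * θ h = θ h * θ σ := by
  let k := IsLocalRing.ResidueField R
  have htors : Module.IsTorsionBySet R M (IsLocalRing.maximalIdeal R : Set R) :=
    fun x r => hM r.1 r.2 x
  let _ : Module k M := htors.module
  have : IsScalarTower R k M := htors.isScalarTower
  have hsurj : Function.Surjective (algebraMap R k) := IsLocalRing.residue_surjective
  have : Module.Finite k M := Module.Finite.of_restrictScalars_finite R k M
  let θ' : Representation k G M :=
    { toFun := fun g => (θ g).extendScalarsOfSurjective hsurj
      map_one' := by ext x; simp
      map_mul' := fun g g' => by ext x; simp }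
  have hlen : Module.length R M = finrank k M := by
    rw [Module.length_eq_of_surjective hsurj, Module.length_eq_finrank]
  have hpk : (p : k) ≠ 0 := by
    rw [← map_natCast (algebraMap R k)]
    exact (hpR.map (algebraMap R k)).ne_zero
  rw [hlen] at hdim
  have := Representation.commute_of_isPGroup hp hℓ hpℓ hpk (by exact_mod_cast hdim) θ' H hH hσ hh
  ext x
  exact LinearMap.congr_fun this x

/-! ### Lengths of quotients of nested submodules -/

section RelLength

variable {R V : Type*} [CommRing R] [AddCommGroup V] [Module R V]

/-- The length of `L ⧸ T` for submodules `T ≤ L`. -/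
noncomputable def relLength (T L : Submodule R V) : ℕ∞ := Module.length R (L ⧸ T.submoduleOf L)

theorem relLength_add {T L P : Submodule R V} (hTL : T ≤ L) (hLP : L ≤ P) :
    relLength T P = relLength T L + relLength L P := by
  let f : (L ⧸ T.submoduleOf L) →ₗ[R] (P ⧸ T.submoduleOf P) :=
    Submodule.mapQ _ _ (Submodule.inclusion hLP) fun x hx => hx
  let g : (P ⧸ T.submoduleOf P) →ₗ[R] (P ⧸ L.submoduleOf P) :=
    Submodule.factor fun x hx => hTL hx
  refine Module.length_eq_add_of_exact f g ?_ ?_ ?_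
  · rw [← LinearMap.ker_eq_bot, LinearMap.ker_eq_bot']
    intro x hx
    obtain ⟨x, rfl⟩ := Submodule.Quotient.mk_surjective _ x
    exact (Submodule.Quotient.mk_eq_zero _).2 ((Submodule.Quotient.mk_eq_zero _).1 hx :)
  · exact Submodule.factor_surjective _
  · intro y
    obtain ⟨y, rfl⟩ := Submodule.Quotient.mk_surjective _ y
    constructor
    · intro h
      have h' : y ∈ L.submoduleOf P := (Submodule.Quotient.mk_eq_zero _).1 h
      exact ⟨Submodule.Quotient.mk ⟨y.1, h'⟩, rfl⟩
    · rintro ⟨x, hx⟩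
      obtain ⟨x, rfl⟩ := Submodule.Quotient.mk_surjective _ x
      rw [← hx]
      exact (Submodule.Quotient.mk_eq_zero _).2 x.2

theorem relLength_eq_zero_iff {T L : Submodule R V} : relLength T L = 0 ↔ L ≤ T := by
  rw [relLength, Module.length_eq_zero_iff, Submodule.Quotient.subsingleton_iff,
    Submodule.submoduleOf_eq_top]

theorem relLength_map {T L : Submodule R V} {φ : V →ₗ[R] V} (hφ : Function.Injective φ) :
    relLength (T.map φ) (L.map φ) = relLength T L := by
  refine LinearEquiv.length_eq (Submodule.Quotient.equiv _ _
    (Submodule.equivMapOfInjective φ hφ L).symm ?_)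
  ext x
  constructor
  · rintro ⟨⟨_, ⟨y, hy, rfl⟩⟩, h, rfl⟩
    obtain ⟨t, ht, hty⟩ := h
    have : t = y := hφ hty
    subst this
    have e : (Submodule.equivMapOfInjective φ hφ L).symm ⟨φ t, ⟨t, hy, rfl⟩⟩ = ⟨t, hy⟩ := by
      rw [LinearEquiv.symm_apply_eq]; rfl
    change (Submodule.equivMapOfInjective φ hφ L).symm ⟨φ t, ⟨t, hy, rfl⟩⟩ ∈ _
    rw [e]
    exact ht
  · intro hx
    refine ⟨Submodule.equivMapOfInjective φ hφ L x, ⟨x.1, hx, rfl⟩, ?_⟩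
    simp

/-- Injectivity of φ makes each successive quotient φ^k L / φ^(k+1) L isomorphic to L / φL. -/
theorem relLength_map_pow {L : Submodule R V} {φ : Module.End R V} (hφ : Function.Injective φ)
    (hL : L.map φ ≤ L) (k : ℕ) :
    L.map (φ ^ k) ≤ L ∧ relLength (L.map (φ ^ k)) L = k * relLength (L.map φ) L := by
  induction k with
  | zero =>
    have : L.map (φ ^ 0) = L := by rw [pow_zero]; exact Submodule.map_id L
    rw [this]
    exact ⟨le_rfl, by simp [relLength_eq_zero_iff]⟩
  | succ k ih =>
    have e : L.map (φ ^ (k + 1)) = (L.map (φ ^ k)).map φ := by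
      rw [pow_succ', ← Submodule.map_comp]; rfl
    have h1 : (L.map (φ ^ k)).map φ ≤ L.map φ := Submodule.map_mono ih.1
    rw [e]
    refine ⟨h1.trans hL, ?_⟩
    rw [relLength_add h1 hL, relLength_map hφ, ih.2]
    push_cast
    ring

theorem relLength_anti {T T' L : Submodule R V} (h : T ≤ T') (h' : T' ≤ L) :
    relLength T' L ≤ relLength T L := by
  rw [relLength_add h h']
  exact le_add_self

end RelLength

theorem lsmul_injective_of_ne_zero {𝒪 V : Type*} (K : Type*) [CommRing 𝒪] [Field K] [Algebra 𝒪 K]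
    [IsFractionRing 𝒪 K] [AddCommGroup V] [Module K V] [Module 𝒪 V] [IsScalarTower 𝒪 K V]
    {a : 𝒪} (ha : a ≠ 0) : Function.Injective (LinearMap.lsmul 𝒪 V a) := by
  intro x y h
  have h' : (algebraMap 𝒪 K a) • x = (algebraMap 𝒪 K a) • y := by simpa using h
  exact smul_right_injective V (by simpa using ha) h'

/-! ### Lattices over a discrete valuation ring -/

section Lattice

variable {𝒪 K V : Type*} [CommRing 𝒪] [IsDomain 𝒪] [IsDiscreteValuationRing 𝒪]
  [Field K] [Algebra 𝒪 K] [IsFractionRing 𝒪 K] [AddCommGroup V] [Module K V] [Module 𝒪 V]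
  [IsScalarTower 𝒪 K V]

/-- The reduction of a lattice modulo a uniformizer has length the dimension. -/
theorem relLength_uniformizer {π : 𝒪} (hπ : Irreducible π) (L : Submodule 𝒪 V)
    [Submodule.IsLattice K L] :
    relLength (L.map (LinearMap.lsmul 𝒪 V π)) L = finrank K V := by
  have : Module.Free 𝒪 L := Submodule.IsLattice.free K L
  let b := Module.finBasis 𝒪 L
  have hr : finrank 𝒪 L = finrank K V := by
    rw [finrank, finrank, Submodule.IsLattice.rank' K L]
  have hsimple : Module.length 𝒪 (𝒪 ⧸ Ideal.span {π}) = 1 := by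
    rw [Module.length_eq_one_iff, isSimpleModule_iff_isCoatom,
      ← hπ.maximalIdeal_eq]
    exact (IsLocalRing.maximalIdeal.isMaximal 𝒪).out
  let e : (L ⧸ (L.map (LinearMap.lsmul 𝒪 V π)).submoduleOf L) ≃ₗ[𝒪]
      ((Fin (finrank 𝒪 L) → 𝒪) ⧸ Submodule.pi Set.univ (fun _ => Ideal.span {π})) :=
    Submodule.Quotient.equiv _ _ b.equivFun (by
      ext x
      simp only [Submodule.mem_map, Submodule.mem_pi, Set.mem_univ, true_imp_iff,
        Ideal.mem_span_singleton]
      constructor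
      · rintro ⟨y, ⟨z, hz, hzy⟩, rfl⟩ i
        have : y = π • (⟨z, hz⟩ : L) := Subtype.ext hzy.symm
        rw [this, map_smul]
        exact dvd_mul_right _ _
      · intro h
        choose c hc using h
        refine ⟨b.equivFun.symm x, ⟨b.equivFun.symm c, Subtype.prop _, ?_⟩,
          b.equivFun.apply_symm_apply x⟩
        have : x = π • c := funext hc
        rw [this, map_smul]
        rfl)
  rw [relLength, e.length_eq, (Submodule.quotientPi _).length_eq, Module.length_pi_of_fintype]
  simp [hsimple, hr]

end Lattice

section General

variable {𝒪 K V : Type*} [CommRing 𝒪] [AddCommGroup V] [Module 𝒪 V]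

theorem lsmul_pow (a : 𝒪) (m : ℕ) :
    LinearMap.lsmul 𝒪 V (a ^ m) = (LinearMap.lsmul 𝒪 V a : Module.End 𝒪 V) ^ m := by
  exact map_pow (Module.toModuleEnd 𝒪 (S := 𝒪) V) a m

theorem map_lsmul_le (L : Submodule 𝒪 V) (a : 𝒪) : L.map (LinearMap.lsmul 𝒪 V a) ≤ L := by
  rintro _ ⟨x, hx, rfl⟩
  exact L.smul_mem _ hx

variable [Field K] [Algebra 𝒪 K] [Module K V] [IsScalarTower 𝒪 K V]

theorem isLattice_span_range_basis {ι : Type*} [Finite ι] (b : Basis ι K V) :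
    Submodule.IsLattice K (Submodule.span 𝒪 (Set.range b)) where
  fg := Submodule.fg_span (Set.finite_range b)
  span_eq_top := by rw [Submodule.span_span_of_tower, b.span_eq]

variable {f : LinearMap.BilinForm K V}

theorem LinearMap.BilinForm.IsAlt.dualSubmodule_flip (hf : f.IsAlt) (T : Submodule 𝒪 V) :
    f.flip.dualSubmodule T = f.dualSubmodule T := by
  ext x
  simp only [LinearMap.BilinForm.mem_dualSubmodule]
  refine forall₂_congr fun y _ => ?_
  rw [LinearMap.BilinForm.flip_apply, ← hf.neg_eq x y, neg_mem_iff]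

theorem dualSubmodule_anti {T L : Submodule 𝒪 V} (h : T ≤ L) :
    f.dualSubmodule L ≤ f.dualSubmodule T :=
  fun _ hx y hy => hx y (h hy)

theorem mem_dualSubmodule_smul {c : 𝒪} {T : Submodule 𝒪 V} {x : V} :
    x ∈ (algebraMap 𝒪 K c • f).dualSubmodule T ↔ c • x ∈ f.dualSubmodule T := by
  simp only [LinearMap.BilinForm.mem_dualSubmodule]
  refine forall₂_congr fun y _ => ?_
  rw [← algebraMap_smul K c x, map_smul]
  rfl

end General

section Lattice

variable {𝒪 K V : Type*} [CommRing 𝒪] [IsDomain 𝒪] [IsDiscreteValuationRing 𝒪]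
  [Field K] [Algebra 𝒪 K] [IsFractionRing 𝒪 K] [AddCommGroup V] [Module K V] [Module 𝒪 V]
  [IsScalarTower 𝒪 K V]

theorem exists_pow_smul_mem_of_isLattice {π : 𝒪} (hπ : Irreducible π) (T : Submodule 𝒪 V)
    [Submodule.IsLattice K T] (x : V) : ∃ m : ℕ, π ^ m • x ∈ T := by
  have hx : x ∈ Submodule.span K (T : Set V) := by
    rw [Submodule.IsLattice.span_eq_top (M := T)]; trivial
  induction hx using Submodule.span_induction with
  | mem x hx => exact ⟨0, by simpa using hx⟩
  | zero => exact ⟨0, by simp⟩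
  | add x y _ _ hx hy =>
    obtain ⟨m, hm⟩ := hx
    obtain ⟨n, hn⟩ := hy
    refine ⟨m + n, ?_⟩
    rw [smul_add]
    refine add_mem ?_ ?_
    · rw [add_comm, pow_add, mul_smul]; exact T.smul_mem _ hm
    · rw [pow_add, mul_smul]; exact T.smul_mem _ hn
  | smul c x _ hx =>
    obtain ⟨m, hm⟩ := hx
    obtain ⟨a, s, hs, rfl⟩ := IsFractionRing.div_surjective (A := 𝒪) c
    obtain ⟨j, u, rfl⟩ :=
      IsDiscreteValuationRing.eq_unit_mul_pow_irreducible (nonZeroDivisors.ne_zero hs) hπ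
    refine ⟨m + j, ?_⟩
    have hπK : algebraMap 𝒪 K π ≠ 0 := by simpa using hπ.ne_zero
    have huK : algebraMap 𝒪 K u ≠ 0 := by simp
    have : π ^ (m + j) • (algebraMap 𝒪 K a / algebraMap 𝒪 K (u * π ^ j)) • x
        = ((↑u⁻¹ : 𝒪) * a) • π ^ m • x := by
      rw [← algebraMap_smul K, ← algebraMap_smul K (_ * a), ← algebraMap_smul K (π ^ m), smul_smul,
        smul_smul]
      congr 1
      have hu : algebraMap 𝒪 K (↑u⁻¹ : 𝒪) * algebraMap 𝒪 K u = 1 := by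
        rw [← map_mul]; simp
      simp only [map_mul, map_pow, pow_add]
      field_simp
      linear_combination (-algebraMap 𝒪 K a) * hu
    rw [this]
    exact T.smul_mem _ hm

theorem exists_map_pow_le_of_isLattice {π : 𝒪} (hπ : Irreducible π) (T L : Submodule 𝒪 V)
    [Submodule.IsLattice K T] (hL : L.FG) : ∃ m : ℕ, ∀ x ∈ L, π ^ m • x ∈ T := by
  obtain ⟨s, rfl⟩ := hL
  choose m hm using exists_pow_smul_mem_of_isLattice hπ T
  refine ⟨s.sup m, fun x hx => ?_⟩
  induction hx using Submodule.span_induction with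
  | mem x hx =>
    obtain ⟨k, hk⟩ := Nat.exists_eq_add_of_le (Finset.le_sup (f := m) hx)
    rw [hk, add_comm, pow_add, mul_smul]
    exact T.smul_mem _ (hm x)
  | zero => simp
  | add x y _ _ hx hy => rw [smul_add]; exact add_mem hx hy
  | smul c x _ hx => rw [smul_comm]; exact T.smul_mem _ hx

theorem relLength_map_uniformizer_pow {π : 𝒪} (hπ : Irreducible π) (L : Submodule 𝒪 V)
    [Submodule.IsLattice K L] (m : ℕ) :
    relLength (L.map (LinearMap.lsmul 𝒪 V (π ^ m))) L = m * finrank K V := by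
  rw [lsmul_pow, (relLength_map_pow (lsmul_injective_of_ne_zero K hπ.ne_zero)
    (map_lsmul_le L π) m).2, relLength_uniformizer (K := K) hπ]

/-- T contains some π^m L, which has finite colength in L. Finiteness allows lengths to be compared
strictly and subtracted. -/
theorem relLength_ne_top {T L : Submodule 𝒪 V} [Submodule.IsLattice K T]
    [Submodule.IsLattice K L] (hTL : T ≤ L) : relLength T L ≠ ⊤ := by
  obtain ⟨π, hπ⟩ := IsDiscreteValuationRing.exists_irreducible 𝒪
  obtain ⟨m, hm⟩ := exists_map_pow_le_of_isLattice (K := K) hπ T L Submodule.IsLattice.fg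
  have h1 : L.map (LinearMap.lsmul 𝒪 V (π ^ m)) ≤ T := by
    rintro _ ⟨x, hx, rfl⟩
    exact hm x hx
  refine ne_top_of_le_ne_top ?_ (relLength_anti h1 hTL)
  rw [relLength_map_uniformizer_pow (K := K) hπ]
  exact WithTop.mul_ne_top (ENat.natCast_ne_top _) (ENat.natCast_ne_top _)

/-- Up to a unit, a is π^e. With a = ℓ this is where the absolute ramification degree enters the
length count. -/
theorem relLength_map_of_addVal {a : 𝒪} {e : ℕ}
    (ha : IsDiscreteValuationRing.addVal 𝒪 a = e) (L : Submodule 𝒪 V)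
    [Submodule.IsLattice K L] :
    relLength (L.map (LinearMap.lsmul 𝒪 V a)) L = e * finrank K V := by
  obtain ⟨π, hπ⟩ := IsDiscreteValuationRing.exists_irreducible 𝒪
  have ha' : IsDiscreteValuationRing.addVal 𝒪 a = IsDiscreteValuationRing.addVal 𝒪 (π ^ e) := by
    rw [ha, hπ.addVal_pow]
  obtain ⟨u, hu⟩ := IsDiscreteValuationRing.addVal_eq_iff_associated _ _ |>.1 ha'
  rw [← relLength_map_uniformizer_pow (K := K) hπ L e, ← hu]
  congr 1
  ext x
  constructor
  · rintro ⟨y, hy, rfl⟩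
    exact ⟨(↑u⁻¹ : 𝒪) • y, L.smul_mem _ hy, by
      rw [LinearMap.lsmul_apply, LinearMap.lsmul_apply, smul_smul, mul_assoc, Units.mul_inv, mul_one]⟩
  · rintro ⟨y, hy, rfl⟩
    exact ⟨(u : 𝒪) • y, L.smul_mem _ hy, by simp [smul_smul, mul_comm]⟩

end Lattice

/-! ### Dual lattices -/

section Dual

variable {𝒪 K V : Type*} [CommRing 𝒪] [IsDomain 𝒪] [IsDiscreteValuationRing 𝒪]
  [Field K] [Algebra 𝒪 K] [IsFractionRing 𝒪 K] [AddCommGroup V] [Module K V] [Module 𝒪 V]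
  [IsScalarTower 𝒪 K V] {f : LinearMap.BilinForm K V}

theorem exists_basis_span_eq_of_isLattice (T : Submodule 𝒪 V) [Submodule.IsLattice K T] :
    ∃ b : Basis (Fin (finrank K V)) K V, T = Submodule.span 𝒪 (Set.range b) := by
  have : Module.Free 𝒪 T := Submodule.IsLattice.free K T
  have hr : finrank 𝒪 T = finrank K V := by
    rw [finrank, finrank, Submodule.IsLattice.rank' K T]
  let b := Module.finBasisOfFinrankEq 𝒪 T hr
  refine ⟨b.extendOfIsLattice K, ?_⟩
  have : Set.range (b.extendOfIsLattice K) = Set.image T.subtype (Set.range b) := by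
    rw [← Set.range_comp]
    congr 1
    ext i
    simp
  rw [this, ← Submodule.map_span, b.span_eq, Submodule.map_top, Submodule.range_subtype]

theorem isLattice_dualSubmodule [FiniteDimensional K V] (hf : f.Nondegenerate)
    (T : Submodule 𝒪 V) [Submodule.IsLattice K T] :
    Submodule.IsLattice K (f.dualSubmodule T) := by
  obtain ⟨b, rfl⟩ := exists_basis_span_eq_of_isLattice (K := K) T
  rw [LinearMap.BilinForm.dualSubmodule_span_of_basis f hf b]
  exact isLattice_span_range_basis _

/-- Dualizing twice through dual bases returns the lattice when the outer dual uses the flipped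
form; for an alternating form the flip changes only a sign. -/
theorem dualSubmodule_dualSubmodule (hf : f.Nondegenerate) (halt : f.IsAlt)
    (T : Submodule 𝒪 V) [Submodule.IsLattice K T] :
    f.dualSubmodule (f.dualSubmodule T) = T := by
  obtain ⟨b, rfl⟩ := exists_basis_span_eq_of_isLattice (K := K) T
  rw [← halt.dualSubmodule_flip,
    LinearMap.BilinForm.dualSubmodule_flip_dualSubmodule_of_basis f hf b]

end Dual

/-! ### Stable integral lattices with minimal discriminant -/

section StableLattice

variable {𝒪 K V G : Type*} [CommRing 𝒪] [Field K] [Algebra 𝒪 K] [AddCommGroup V] [Module K V]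
  [Module 𝒪 V] [IsScalarTower 𝒪 K V] [Group G]

/-- `f` is a nondegenerate alternating `G`-invariant form. -/
structure Representation.IsSymplecticForm (ρ : Representation K G V)
    (f : LinearMap.BilinForm K V) : Prop where
  nondegenerate : f.Nondegenerate
  isAlt : f.IsAlt
  invariant : ∀ (g : G) (x y : V), f (ρ g x) (ρ g y) = f x y

/-- `T` is a `G`-stable lattice on which `f` takes integral values. -/
structure Representation.IsIntegralLattice (ρ : Representation K G V)
    (f : LinearMap.BilinForm K V) (T : Submodule 𝒪 V) : Prop where
  isLattice : Submodule.IsLattice K T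
  stable : ∀ (g : G), ∀ x ∈ T, ρ g x ∈ T
  le_dual : T ≤ f.dualSubmodule T

theorem Representation.IsSymplecticForm.smul {ρ : Representation K G V}
    {f : LinearMap.BilinForm K V} (hf : ρ.IsSymplecticForm f) {c : K} (hc : c ≠ 0) :
    ρ.IsSymplecticForm (c • f) where
  nondegenerate := by
    have halt : (c • f).IsAlt := fun x => by simp [hf.isAlt x]
    refine (LinearMap.IsRefl.nondegenerate_iff_separatingLeft
      (LinearMap.BilinForm.IsAlt.isRefl halt)).2 fun x hx => ?_
    exact hf.nondegenerate.1 x fun y => by simpa [hc] using hx y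
  isAlt := fun x => by simp [hf.isAlt x]
  invariant := fun g x y => by simp [hf.invariant g x y]

theorem Representation.IsSymplecticForm.apply_left {ρ : Representation K G V}
    {f : LinearMap.BilinForm K V} (hf : ρ.IsSymplecticForm f) (g : G) (x y : V) :
    f (ρ g x) y = f x (ρ g⁻¹ y) := by
  rw [← hf.invariant g x (ρ g⁻¹ y), Representation.self_inv_apply]

theorem Representation.IsSymplecticForm.dual_stable {ρ : Representation K G V}
    {f : LinearMap.BilinForm K V} (hf : ρ.IsSymplecticForm f) {T : Submodule 𝒪 V}
    (hT : ∀ (g : G), ∀ x ∈ T, ρ g x ∈ T) (g : G) :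
    ∀ x ∈ f.dualSubmodule T, ρ g x ∈ f.dualSubmodule T := by
  intro x hx y hy
  rw [hf.apply_left]
  exact hx _ (hT _ y hy)

/-- A finite group stabilizes some lattice. -/
theorem Representation.exists_stable_isLattice [Finite G] [FiniteDimensional K V]
    (ρ : Representation K G V) :
    ∃ T : Submodule 𝒪 V, Submodule.IsLattice K T ∧ ∀ (g : G), ∀ x ∈ T, ρ g x ∈ T := by
  let L : Submodule 𝒪 V := Submodule.span 𝒪 (Set.range (Module.finBasis K V))
  have hL : Submodule.IsLattice K L := isLattice_span_range_basis _
  let T : Submodule 𝒪 V := ⨆ g : G, L.map ((ρ g).restrictScalars 𝒪)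
  have hLT : L ≤ T := by
    refine le_trans ?_ (le_iSup (fun g : G => L.map ((ρ g).restrictScalars 𝒪)) 1)
    intro x hx
    exact ⟨x, hx, by simp⟩
  refine ⟨T, Submodule.IsLattice.of_le_of_isLattice_of_fg K hLT ?_, ?_⟩
  · exact Submodule.fg_iSup _ fun g => hL.fg.map _
  · intro g x hx
    have : T ≤ T.comap ((ρ g).restrictScalars 𝒪) := by
      refine iSup_le fun g' => ?_
      rintro _ ⟨y, hy, rfl⟩
      refine (le_iSup (fun g : G => L.map ((ρ g).restrictScalars 𝒪)) (g * g')) ⟨y, hy, ?_⟩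
      simp
    exact this hx

variable [IsDomain 𝒪] [IsDiscreteValuationRing 𝒪] [IsFractionRing 𝒪 K] [FiniteDimensional K V]

/-- A stable lattice T becomes integral after scaling by any π^m that carries T into its dual. -/
theorem Representation.IsSymplecticForm.exists_isIntegralLattice [Finite G]
    {ρ : Representation K G V} {f : LinearMap.BilinForm K V} (hf : ρ.IsSymplecticForm f) :
    ∃ T : Submodule 𝒪 V, ρ.IsIntegralLattice f T := by
  obtain ⟨π, hπ⟩ := IsDiscreteValuationRing.exists_irreducible 𝒪
  obtain ⟨T, hT, hTs⟩ := ρ.exists_stable_isLattice (𝒪 := 𝒪)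
  have := isLattice_dualSubmodule hf.nondegenerate T
  obtain ⟨m, hm⟩ := exists_map_pow_le_of_isLattice (K := K) hπ (f.dualSubmodule T) T hT.fg
  have hc : algebraMap 𝒪 K (π ^ m) ≠ 0 := by
    simpa using pow_ne_zero m hπ.ne_zero
  refine ⟨T.map (LinearMap.lsmul 𝒪 V (π ^ m)), ⟨hT.fg.map _, ?_⟩, ?_, ?_⟩
  · rw [eq_top_iff, ← hT.span_eq_top, Submodule.span_le]
    intro x hx
    have h1 : π ^ m • x ∈ Submodule.span K
        ((T.map (LinearMap.lsmul 𝒪 V (π ^ m)) : Submodule 𝒪 V) : Set V) :=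
      Submodule.subset_span ⟨x, hx, rfl⟩
    have h2 := Submodule.smul_mem _ (algebraMap 𝒪 K (π ^ m))⁻¹ h1
    rwa [← algebraMap_smul K (π ^ m) x, inv_smul_smul₀ hc] at h2
  · rintro g _ ⟨x, hx, rfl⟩
    exact ⟨ρ g x, hTs g x hx, by
      rw [LinearMap.lsmul_apply, LinearMap.lsmul_apply, LinearMap.map_smul_of_tower]⟩
  · rintro _ ⟨x, hx, rfl⟩ _ ⟨y, hy, rfl⟩
    have := (1 : Submodule 𝒪 K).smul_mem (π ^ m) (hm x hx y hy)
    rwa [← LinearMap.map_smul_of_tower] at this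

/-- After scaling the form there is an integral lattice that is maximal and whose discriminant
module is killed by the uniformizer and has length at most half the dimension. -/
theorem Representation.IsSymplecticForm.exists_minimal_isIntegralLattice [Finite G]
    {ρ : Representation K G V} {f : LinearMap.BilinForm K V} (hf : ρ.IsSymplecticForm f)
    {π : 𝒪} (hπ : Irreducible π) :
    ∃ (f' : LinearMap.BilinForm K V) (T : Submodule 𝒪 V), ρ.IsSymplecticForm f' ∧
      ρ.IsIntegralLattice f' T ∧
      (∀ T' : Submodule 𝒪 V, ρ.IsIntegralLattice f' T' → T ≤ T' → T' ≤ T) ∧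
      (∀ x ∈ f'.dualSubmodule T, π • x ∈ T) ∧
      2 * relLength T (f'.dualSubmodule T) ≤ finrank K V := by
  -- The minimum is taken over the scaling i as well as the lattice. Varying i is what yields the
  -- bound by half the dimension.
  let F : ℕ → LinearMap.BilinForm K V := fun i => algebraMap 𝒪 K (π ^ i) • f
  have hF : ∀ i, ρ.IsSymplecticForm (F i) := fun i =>
    hf.smul (by simpa using pow_ne_zero i hπ.ne_zero)
  obtain ⟨T₀, hT₀⟩ := (hF 0).exists_isIntegralLattice (𝒪 := 𝒪)
  obtain ⟨N, ⟨i, T, hT, rfl⟩, hmin⟩ := wellFounded_lt.has_min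
    {N : ℕ∞ | ∃ i, ∃ T : Submodule 𝒪 V, ρ.IsIntegralLattice (F i) T ∧
      relLength T ((F i).dualSubmodule T) = N} ⟨_, 0, T₀, hT₀, rfl⟩
  have hlat := hT.isLattice
  have hnd := (hF i).nondegenerate
  have halt := (hF i).isAlt
  have hdual := isLattice_dualSubmodule hnd T
  have hmax : ∀ T' : Submodule 𝒪 V, ρ.IsIntegralLattice (F i) T' → T ≤ T' → T' ≤ T := by
    intro T' hT' hTT'
    by_contra hle
    have := hT'.isLattice
    have hdual' := isLattice_dualSubmodule hnd T'
    have h1 := hT'.le_dual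
    have h2 : (F i).dualSubmodule T' ≤ (F i).dualSubmodule T := dualSubmodule_anti hTT'
    apply hmin _ ⟨i, T', hT', rfl⟩
    rw [relLength_add hTT' (h1.trans h2), relLength_add h1 h2]
    have h3 : relLength T T' ≠ 0 := fun h => hle (relLength_eq_zero_iff.1 h)
    have h4 := relLength_ne_top (K := K) h1
    have h5 : relLength T' ((F i).dualSubmodule T')
        < relLength T T' + relLength T' ((F i).dualSubmodule T') :=
      ENat.lt_add_left h4 (pos_of_ne_zero h3)
    refine h5.trans_le ?_
    gcongr
    exact le_self_add
  have hkill : ∀ x ∈ (F i).dualSubmodule T, π • x ∈ T := by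
    obtain ⟨m, hm⟩ := exists_map_pow_le_of_isLattice (K := K) hπ T ((F i).dualSubmodule T) hdual.fg
    clear hmin
    induction m with
    | zero => intro x hx; exact T.smul_mem _ (by simpa using hm x hx)
    | succ m ih =>
      rcases Nat.eq_zero_or_pos m with rfl | hm0
      · simpa using hm
      apply ih
      -- If π^(m+1) kills the discriminant module and m ≥ 1, then 2m ≥ m + 1 makes T' integral.
      -- Maximality then shows that π^m already kills it.
      let T' : Submodule 𝒪 V := T ⊔ ((F i).dualSubmodule T).map (LinearMap.lsmul 𝒪 V (π ^ m))
      have hT'le : T' ≤ (F i).dualSubmodule T :=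
        sup_le hT.le_dual (map_lsmul_le _ _)
      have key := hmax T' ⟨?_, ?_, ?_⟩ le_sup_left
      · intro x hx
        exact key (Submodule.mem_sup_right ⟨x, hx, rfl⟩)
      · exact Submodule.IsLattice.of_le_of_isLattice_of_fg K le_sup_left
          (hlat.fg.sup (hdual.fg.map _))
      · intro g x hx
        have : T' ≤ T'.comap ((ρ g).restrictScalars 𝒪) := by
          refine sup_le (fun y hy => Submodule.mem_sup_left (hT.stable g y hy)) ?_
          rintro _ ⟨y, hy, rfl⟩
          refine Submodule.mem_sup_right ⟨ρ g y, (hF i).dual_stable hT.stable g y hy, ?_⟩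
          exact (LinearMap.map_smul_of_tower (ρ g) (π ^ m) y).symm
        exact this hx
      · refine sup_le (fun t ht y hy => ?_) ?_
        · have := hT'le hy t ht
          rwa [← halt.neg_eq, neg_mem_iff] at this
        · rintro _ ⟨x, hx, rfl⟩ y hy
          obtain ⟨t, ht, _, ⟨z, hz, rfl⟩, rfl⟩ := Submodule.mem_sup.1 hy
          rw [map_add]
          refine add_mem (((F i).dualSubmodule T).smul_mem _ hx t ht) ?_
          have h1 := hz _ (hm x hx)
          rw [← halt.neg_eq, neg_mem_iff] at h1
          have h2 := (1 : Submodule 𝒪 K).smul_mem (π ^ (m - 1)) h1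
          have e : (F i) (LinearMap.lsmul 𝒪 V (π ^ m) x) (LinearMap.lsmul 𝒪 V (π ^ m) z)
              = π ^ (m - 1) • (F i) (π ^ (m + 1) • x) z := by
            simp only [LinearMap.lsmul_apply, LinearMap.map_smul_of_tower, LinearMap.smul_apply,
              smul_smul, ← pow_add]
            congr 2
            omega
          rw [e]
          exact h2
  refine ⟨F i, T, hF i, hT, hmax, hkill, ?_⟩
  -- compare with the dual lattice for the form scaled by the uniformizer
  have hFs : F (i + 1) = algebraMap 𝒪 K π • F i := by
    simp only [F, smul_smul, ← map_mul, pow_succ']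
  let L := (F i).dualSubmodule T
  have hLL : (F i).dualSubmodule L = T := dualSubmodule_dualSubmodule hnd halt T
  have hL : ρ.IsIntegralLattice (F (i + 1)) L := by
    refine ⟨hdual, (hF i).dual_stable hT.stable, fun x hx => ?_⟩
    rw [hFs, mem_dualSubmodule_smul, hLL]
    exact hkill x hx
  have hle := not_lt.1 (hmin _ ⟨i + 1, L, hL, rfl⟩)
  have hπinj := lsmul_injective_of_ne_zero (V := V) K hπ.ne_zero
  -- For the scaled form the dual of L is π⁻¹T, so its discriminant module is isomorphic to T/πL, of
  -- length dim V minus that of L/T. Minimality compares the two.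
  have hmap : ((F (i + 1)).dualSubmodule L).map (LinearMap.lsmul 𝒪 V π) = T := by
    ext x
    constructor
    · rintro ⟨y, hy, rfl⟩
      have hy' : y ∈ (F (i + 1)).dualSubmodule L := hy
      rw [hFs, mem_dualSubmodule_smul, hLL] at hy'
      exact hy'
    · intro hx
      have hπK : algebraMap 𝒪 K π ≠ 0 := by simpa using hπ.ne_zero
      have e : π • (algebraMap 𝒪 K π)⁻¹ • x = x := by
        rw [← algebraMap_smul K π, smul_inv_smul₀ hπK]
      refine ⟨(algebraMap 𝒪 K π)⁻¹ • x, ?_, e⟩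
      have : (algebraMap 𝒪 K π)⁻¹ • x ∈ (F (i + 1)).dualSubmodule L := by
        rw [hFs, mem_dualSubmodule_smul, hLL, e]; exact hx
      exact this
  rw [← relLength_map (T := L) hπinj, hmap] at hle
  have hπL : L.map (LinearMap.lsmul 𝒪 V π) ≤ T := by
    rintro _ ⟨x, hx, rfl⟩; exact hkill x hx
  rw [← relLength_uniformizer (K := K) hπ L, relLength_add hπL hT.le_dual, two_mul]
  gcongr

end StableLattice

/-! ### Self-dual lattices when the group order is invertible -/

section SelfDual

variable {𝒪 K V G : Type*} [CommRing 𝒪] [Field K] [Algebra 𝒪 K] [AddCommGroup V] [Module K V]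
  [Module 𝒪 V] [IsScalarTower 𝒪 K V] [Group G]

/-- The representation has a stable lattice which is self-dual for some symplectic form. -/
def Representation.HasSelfDualLattice (𝒪 : Type*) [CommRing 𝒪] [Algebra 𝒪 K] [Module 𝒪 V]
    [IsScalarTower 𝒪 K V] (ρ : Representation K G V) : Prop :=
  ∃ (f : LinearMap.BilinForm K V) (T : Submodule 𝒪 V), ρ.IsSymplecticForm f ∧
    ρ.IsIntegralLattice f T ∧ f.dualSubmodule T ≤ T

variable [IsDomain 𝒪] [IsDiscreteValuationRing 𝒪] [IsFractionRing 𝒪 K]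

/-- An integral lattice on which an alternating form is nondegenerate modulo the uniformizer is
self-dual. -/
theorem Representation.hasSelfDualLattice_of_residually_nondegenerate
    {ρ : Representation K G V} {f : LinearMap.BilinForm K V} {π : 𝒪} (hπ : Irreducible π)
    (halt : f.IsAlt) (hinv : ∀ (g : G) (x y : V), f (ρ g x) (ρ g y) = f x y)
    {T : Submodule 𝒪 V} (hT : ρ.IsIntegralLattice f T)
    (h : ∀ x ∈ T, (∀ y ∈ T, ∃ a ∈ (1 : Submodule 𝒪 K), f x y = π • a) → ∃ x' ∈ T, x = π • x') :
    ρ.HasSelfDualLattice 𝒪 := by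
  have hlat := hT.isLattice
  have hinj := lsmul_injective_of_ne_zero (V := V) K hπ.ne_zero
  -- If x is in the dual and π^(m+1) x ∈ T, this vector pairs with T into π𝒪. By hypothesis it lies
  -- in πT, so π^m x ∈ T, and m descends to 0.
  have hdual : f.dualSubmodule T ≤ T := by
    intro x hx
    obtain ⟨m, hm⟩ := exists_pow_smul_mem_of_isLattice (K := K) hπ T x
    induction m with
    | zero => simpa using hm
    | succ m ih =>
      apply ih
      obtain ⟨x', hx', e⟩ := h _ hm fun y hy => by
        refine ⟨π ^ m • f x y, (1 : Submodule 𝒪 K).smul_mem _ (hx y hy), ?_⟩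
        rw [smul_smul, ← pow_succ', LinearMap.map_smul_of_tower, LinearMap.smul_apply]
      rw [pow_succ', mul_smul] at e
      have : π ^ m • x = x' := hinj e
      rwa [this]
  refine ⟨f, T, ⟨?_, halt, hinv⟩, hT, hdual⟩
  refine (LinearMap.IsRefl.nondegenerate_iff_separatingLeft
    (LinearMap.BilinForm.IsAlt.isRefl halt)).2 fun x hx => ?_
  have hmem : ∀ c : K, c • x ∈ T := fun c => hdual fun y _ => by
    rw [map_smul, LinearMap.smul_apply, hx y, smul_zero]; exact zero_mem _
  have hπK : algebraMap 𝒪 K π ≠ 0 := by simpa using hπ.ne_zero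
  have hx1 : x ∈ T := by simpa using hmem 1
  -- A vector in the radical has its whole K-line inside T, so it is divisible by every power of π
  -- and vanishes by Krull's intersection theorem.
  have hkr := Ideal.iInf_pow_smul_eq_bot_of_isLocalRing (M := T) (IsLocalRing.maximalIdeal 𝒪)
    (IsLocalRing.maximalIdeal.isMaximal 𝒪).ne_top
  have : (⟨x, hx1⟩ : T) ∈ (⨅ i : ℕ, IsLocalRing.maximalIdeal 𝒪 ^ i • ⊤ : Submodule 𝒪 T) := by
    rw [Submodule.mem_iInf]
    intro i
    have e : (⟨x, hx1⟩ : T) = π ^ i • ⟨_, hmem ((algebraMap 𝒪 K (π ^ i))⁻¹)⟩ := by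
      apply Subtype.ext
      change x = π ^ i • _ • x
      rw [← algebraMap_smul K (π ^ i), smul_inv_smul₀]
      simpa using pow_ne_zero i hπ.ne_zero
    rw [e]
    refine Submodule.smul_mem_smul (Ideal.pow_mem_pow ?_ i) Submodule.mem_top
    rw [hπ.maximalIdeal_eq]
    exact Ideal.mem_span_singleton_self π
  rw [hkr, Submodule.mem_bot] at this
  exact congrArg Subtype.val this

/-- A projection onto a sublattice modulo the uniformizer. -/
theorem exists_linearMap_of_le {π : 𝒪} (hπ : Irreducible π) {T L : Submodule 𝒪 V}
    [Submodule.IsLattice K L] (hTL : T ≤ L) :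
    ∃ p : V →ₗ[K] V, (∀ x ∈ L, p x ∈ T) ∧ ∀ t ∈ T, ∃ l ∈ L, p t - t = π • l := by
  classical
  have : Module.Free 𝒪 L := Submodule.IsLattice.free K L
  obtain ⟨n, bL, bT, φ, a, snf⟩ := Submodule.smithNormalForm (Module.finBasis 𝒪 L)
    (T.submoduleOf L)
  let b := bL.extendOfIsLattice K
  -- In a Smith basis, p keeps the vectors whose elementary divisor is a unit and kills the others.
  -- In elements of T, the killed vectors have coefficients divisible by π.
  let p : V →ₗ[K] V :=
    b.constr K fun j => if ∃ i, φ i = j ∧ IsUnit (a i) then (bL j : V) else 0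
  have hp : ∀ j, p (bL j : V) = if ∃ i, φ i = j ∧ IsUnit (a i) then (bL j : V) else 0 := by
    intro j
    have : (bL j : V) = b j := by simp [b]
    rw [this, Basis.constr_basis]
    simp [b]
  have hpO : ∀ (c : 𝒪) (x : V), p (c • x) = c • p x := fun c x => LinearMap.map_smul_of_tower p c x
  refine ⟨p, fun x hx => ?_, fun t ht => ?_⟩
  · have key : ∀ y : L, p y ∈ T := by
      intro y
      rw [← bL.sum_repr y]
      simp only [Submodule.coe_sum, Submodule.coe_smul, map_sum, hpO]
      refine sum_mem fun j _ => T.smul_mem _ ?_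
      rw [hp]
      split_ifs with h
      · obtain ⟨i, rfl, u, hu⟩ := h
        have h1 : (bT i : L).1 ∈ T := (bT i).2
        rw [snf i, ← hu] at h1
        have h2 := T.smul_mem (↑u⁻¹ : 𝒪) h1
        rw [Submodule.coe_smul, smul_smul, Units.inv_mul, one_smul] at h2
        exact h2
      · exact zero_mem _
    exact key ⟨x, hx⟩
  · have key : ∀ y : T.submoduleOf L, ∃ l ∈ L, p (y : L) - (y : L) = π • l := by
      intro y
      suffices h : p (y : L).1 - (y : L).1 ∈ L.map (LinearMap.lsmul 𝒪 V π) by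
        obtain ⟨l, hl, e⟩ := h
        exact ⟨l, hl, e.symm⟩
      rw [← bT.sum_repr y]
      simp only [Submodule.coe_sum, Submodule.coe_smul, map_sum, hpO, ← Finset.sum_sub_distrib,
        ← smul_sub]
      refine sum_mem fun i _ => Submodule.smul_mem _ _ ?_
      rw [snf i, Submodule.coe_smul, hpO, ← smul_sub, hp]
      split_ifs with h
      · simp
      · have hi : ¬ IsUnit (a i) := fun hu => h ⟨i, rfl, hu⟩
        have : a i ∈ IsLocalRing.maximalIdeal 𝒪 := (IsLocalRing.mem_maximalIdeal _).2 hi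
        rw [hπ.maximalIdeal_eq, Ideal.mem_span_singleton] at this
        obtain ⟨c, hc⟩ := this
        refine ⟨c • -(bL (φ i) : V), L.smul_mem _ (L.neg_mem (bL (φ i)).2), ?_⟩
        rw [LinearMap.lsmul_apply, smul_smul, ← hc, zero_sub]
    exact key ⟨⟨t, hTL ht⟩, ht⟩

/-- Equivariant version of `exists_linearMap_of_le`. -/
theorem Representation.exists_equivariant_linearMap_of_le [Finite G] (ρ : Representation K G V)
    (hcard : IsUnit (Nat.card G : 𝒪)) {π : 𝒪} (hπ : Irreducible π) {T L : Submodule 𝒪 V}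
    [Submodule.IsLattice K L] (hTL : T ≤ L) (hT : ∀ (g : G), ∀ x ∈ T, ρ g x ∈ T)
    (hL : ∀ (g : G), ∀ x ∈ L, ρ g x ∈ L) :
    ∃ p : V →ₗ[K] V, (∀ x ∈ L, p x ∈ T) ∧ (∀ t ∈ T, ∃ l ∈ L, p t - t = π • l) ∧
      ∀ (g : G) (x : V), p (ρ g x) = ρ g (p x) := by
  have := Fintype.ofFinite G
  obtain ⟨p₀, hp₀T, hp₀⟩ := exists_linearMap_of_le (K := K) hπ hTL
  obtain ⟨u, hu⟩ := hcard
  let c : 𝒪 := (↑u⁻¹ : 𝒪)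
  have hc : c * (Fintype.card G : 𝒪) = 1 := by
    rw [← Nat.card_eq_fintype_card, ← hu]; simp [c]
  let p : V →ₗ[K] V := c • ∑ g : G, ρ g ∘ₗ p₀ ∘ₗ ρ g⁻¹
  have hp : ∀ x, p x = c • ∑ g : G, ρ g (p₀ (ρ g⁻¹ x)) := fun x => by simp [p]
  refine ⟨p, fun x hx => ?_, fun t ht => ?_, fun h x => ?_⟩
  · rw [hp]
    exact T.smul_mem _ (sum_mem fun g _ => hT g _ (hp₀T _ (hL _ _ hx)))
  · have ht' : t = c • ∑ g : G, ρ g (ρ g⁻¹ t) := by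
      simp only [Representation.self_inv_apply, Finset.sum_const, Finset.card_univ]
      rw [← Nat.cast_smul_eq_nsmul 𝒪, smul_smul, hc, one_smul]
    suffices h : p t - t ∈ L.map (LinearMap.lsmul 𝒪 V π) by
      obtain ⟨l, hl, e⟩ := h
      exact ⟨l, hl, e.symm⟩
    rw [hp]
    nth_rewrite 2 [ht']
    rw [← smul_sub, ← Finset.sum_sub_distrib]
    refine Submodule.smul_mem _ _ (sum_mem fun g _ => ?_)
    obtain ⟨l, hl, e⟩ := hp₀ _ (hT g⁻¹ t ht)
    rw [← map_sub, e]
    exact ⟨ρ g l, hL g l hl, (LinearMap.map_smul_of_tower (ρ g) π l).symm⟩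
  · rw [hp, hp, LinearMap.map_smul_of_tower, map_sum]
    congr 1
    refine Fintype.sum_equiv (Equiv.mulLeft h⁻¹) _ _ fun g => ?_
    have e1 : ρ g⁻¹ (ρ h x) = ρ (h⁻¹ * g)⁻¹ x := by
      rw [← Module.End.mul_apply, ← map_mul, mul_inv_rev, inv_inv]
    rw [e1, Equiv.coe_mulLeft, ← Module.End.mul_apply (ρ h), ← map_mul, mul_inv_cancel_left]

/-- When the order of the group is invertible, a lattice between its dual and the uniformizer
multiple of its dual gives rise to a self-dual lattice. -/
theorem Representation.IsSymplecticForm.hasSelfDualLattice_of_isUnit_card [Finite G]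
    [FiniteDimensional K V]
    {ρ : Representation K G V} {f : LinearMap.BilinForm K V} (hf : ρ.IsSymplecticForm f)
    (hcard : IsUnit (Nat.card G : 𝒪)) {π : 𝒪} (hπ : Irreducible π) {T : Submodule 𝒪 V}
    (hT : ρ.IsIntegralLattice f T) (hkill : ∀ x ∈ f.dualSubmodule T, π • x ∈ T) :
    ρ.HasSelfDualLattice 𝒪 := by
  have hlat := hT.isLattice
  let L := f.dualSubmodule T
  have hL : Submodule.IsLattice K L := isLattice_dualSubmodule hf.nondegenerate T
  have hLL : f.dualSubmodule L = T := dualSubmodule_dualSubmodule hf.nondegenerate hf.isAlt T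
  have hLs := hf.dual_stable hT.stable
  obtain ⟨p, hpT, hpt, hpG⟩ := ρ.exists_equivariant_linearMap_of_le hcard hπ hT.le_dual
    hT.stable hLs
  let q : V →ₗ[K] V := LinearMap.id - p
  have hq : ∀ x, q x = x - p x := fun x => rfl
  have hTL : ∀ x ∈ T, x ∈ L := hT.le_dual
  have hqL : ∀ x ∈ L, q x ∈ L := fun x hx => L.sub_mem hx (hTL _ (hpT x hx))
  -- integrality of the form between the lattice and its dual
  have hLT : ∀ x ∈ L, ∀ t ∈ T, f x t ∈ (1 : Submodule 𝒪 K) := fun x hx t ht => hx t ht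
  have hTL' : ∀ t ∈ T, ∀ x ∈ L, f t x ∈ (1 : Submodule 𝒪 K) := fun t ht x hx => by
    rw [← hf.isAlt.neg_eq, neg_mem_iff]; exact hx t ht
  have hsl : ∀ (c : 𝒪) (x y : V), f (c • x) y = c • f x y := fun c x y => by
    rw [LinearMap.map_smul_of_tower, LinearMap.smul_apply]
  have hsr : ∀ (c : 𝒪) (x y : V), f x (c • y) = c • f x y := fun c x y => by
    rw [LinearMap.map_smul_of_tower]
  -- Modulo π, the form f on T has radical πL, and πf on L has radical T. Glued along p and q, they
  -- are nondegenerate on T/πL ⊕ L/T, that is, on L/πL.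
  let F : LinearMap.BilinForm K V := f.comp p p + algebraMap 𝒪 K π • f.comp q q
  have hF : ∀ x y, F x y = f (p x) (p y) + π • f (q x) (q y) := fun x y => by
    simp [F, Algebra.smul_def]
  have hπf : ∀ x ∈ L, ∀ y ∈ L, π • f x y ∈ (1 : Submodule 𝒪 K) := fun x hx y hy => by
    rw [← hsl]; exact hTL' _ (hkill x hx) y hy
  have hFL : ∀ x ∈ L, ∀ y ∈ L, F x y ∈ (1 : Submodule 𝒪 K) := fun x hx y hy => by
    rw [hF]
    exact add_mem (hTL' _ (hpT x hx) _ (hTL _ (hpT y hy))) (hπf _ (hqL x hx) _ (hqL y hy))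
  refine Representation.hasSelfDualLattice_of_residually_nondegenerate (f := F) (T := L) hπ
    (fun x => by rw [hF, hf.isAlt, hf.isAlt]; simp) (fun g x y => ?_) ⟨hL, hLs, fun x hx => hFL x hx⟩
    fun x hx h => ?_
  · simp only [hF, hq, hpG, ← map_sub, hf.invariant]
  · -- first, `p x ∈ π L`
    have hπK : algebraMap 𝒪 K π ≠ 0 := by simpa using hπ.ne_zero
    let x₁ := (algebraMap 𝒪 K π)⁻¹ • p x
    have hx₁e : π • x₁ = p x := by
      rw [← algebraMap_smul K π, smul_inv_smul₀ hπK]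
    have hcancel : ∀ a b : K, π • a = π • b → a = b := fun a b hab => by
      rw [Algebra.smul_def, Algebra.smul_def] at hab
      exact mul_left_cancel₀ hπK hab
    have hx₁ : x₁ ∈ L := by
      intro t ht
      obtain ⟨a, ha, hae⟩ := h t (hTL t ht)
      obtain ⟨l, hl, hle⟩ := hpt t ht
      have e1 : p t = t + π • l := by rw [← hle]; abel
      have e2 : q t = π • (-l) := by rw [hq, e1, smul_neg]; abel
      rw [hF, e1, e2, map_add, hsr, hsr, ← hx₁e, hsl, ← smul_add, ← smul_add] at hae
      have h1 := hcancel _ _ hae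
      have h2 : f x₁ t = a - f (p x) l - π • f (q x) (-l) := by
        rw [← h1, hx₁e]; abel
      rw [h2]
      exact sub_mem (sub_mem ha (hTL' _ (hpT x hx) l hl)) (hπf _ (hqL x hx) _ (L.neg_mem hl))
    -- With p x = π x₁, the hypothesis divided by π makes f (q x) integral on L, and the dual of L
    -- is T.
    have hqT : q x ∈ T := by
      rw [← hLL]
      intro y hy
      obtain ⟨a, ha, hae⟩ := h y hy
      rw [hF, ← hx₁e, hsl, ← smul_add] at hae
      have h1 := hcancel _ _ hae
      have h2 : f (q x) y = a - f x₁ (p y) + f (q x) (p y) := by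
        rw [← h1, hq y, map_sub]; abel
      rw [h2]
      exact add_mem (sub_mem ha (hLT _ hx₁ _ (hpT y hy))) (hLT _ (hqL x hx) _ (hpT y hy))
    have hxT : x ∈ T := by
      have : x = p x + q x := by rw [hq]; abel
      rw [this]
      exact add_mem (hpT x hx) hqT
    obtain ⟨l, hl, hle⟩ := hpt x hxT
    refine ⟨x₁ - l, L.sub_mem hx₁ hl, ?_⟩
    rw [smul_sub, hx₁e, ← hle]; abel

end SelfDual

/-! ### Automorphisms of order ℓ and the ramification bound -/

section Ramification

-- An integral analogue of ℓ = unit · (ζ - 1)^(ℓ-1). Here W = ℓ(1 + Xs) + X^(ℓ-1), and multiplying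
-- by the truncated geometric series for (1 + Xs)⁻¹ expresses ℓ through W and X^(ℓ-1).
open Polynomial in
theorem exists_prime_eq_add_mul_pow {ℓ : ℕ} (hℓ : ℓ.Prime) :
    ∃ W c d : ℤ[X], X * W = (X + 1) ^ ℓ - 1 ∧ (ℓ : ℤ[X]) = W * d + X ^ (ℓ - 1) * c := by
  obtain ⟨s, hs⟩ : ∃ s : ℤ[X], (X + 1) ^ ℓ = X ^ ℓ + 1 + (ℓ : ℤ[X]) * (X * (1 + X * s)) := by
    refine ⟨∑ k ∈ Finset.Ioo 1 ℓ, X ^ (k - 2) * ((ℓ.choose k / ℓ : ℕ) : ℤ[X]), ?_⟩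
    have h1 : Finset.Ioo 0 ℓ = insert 1 (Finset.Ioo 1 ℓ) := by
      ext k
      have := hℓ.two_le
      simp only [Finset.mem_Ioo, Finset.mem_insert]
      omega
    rw [add_pow_prime_eq hℓ, one_pow, h1, Finset.sum_insert (by simp), Nat.choose_one_right,
      Nat.div_self hℓ.pos, mul_one, mul_assoc, Finset.mul_sum]
    congr 4
    · simp
    · refine Finset.sum_congr rfl fun k hk => ?_
      have hk' := (Finset.mem_Ioo.1 hk).1
      obtain ⟨j, rfl⟩ : ∃ j, k = j + 2 := ⟨k - 2, by omega⟩
      simp only [one_pow, Nat.add_sub_cancel, show j + 2 - 1 = j + 1 by omega]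
      ring
  have hpow : (X : ℤ[X]) ^ ℓ = X * X ^ (ℓ - 1) := by
    rw [← pow_succ', Nat.sub_add_cancel hℓ.pos]
  have hgeom := mul_neg_geom_sum (-(X * s)) (ℓ - 1)
  refine ⟨(ℓ : ℤ[X]) * (1 + X * s) + X ^ (ℓ - 1),
    (ℓ : ℤ[X]) * (-s) ^ (ℓ - 1) - ∑ i ∈ Finset.range (ℓ - 1), (-(X * s)) ^ i,
    ∑ i ∈ Finset.range (ℓ - 1), (-(X * s)) ^ i, ?_, ?_⟩
  · rw [hs, hpow]; ring
  · have e : (-(X * s)) ^ (ℓ - 1) = X ^ (ℓ - 1) * (-s) ^ (ℓ - 1) := by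
      rw [← mul_pow]; congr 1; ring
    rw [e] at hgeom
    linear_combination (-(ℓ : ℤ[X])) * hgeom

variable {𝒪 K V : Type*} [CommRing 𝒪] [Field K] [Algebra 𝒪 K] [AddCommGroup V] [Module K V]
  [Module 𝒪 V] [IsScalarTower 𝒪 K V]

/-- If `τ` has order `ℓ` and no fixed vectors, then `ℓ L ⊆ (τ - 1) ^ (ℓ - 1) L`. -/
theorem map_prime_le_map_sub_one_pow {ℓ : ℕ} (hℓ : ℓ.Prime) {L : Submodule 𝒪 V}
    {τ : Module.End 𝒪 V} (hτ : τ ^ ℓ = 1) (hL : ∀ x ∈ L, τ x ∈ L)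
    (hinj : Function.Injective (τ - 1 : Module.End 𝒪 V)) :
    L.map (LinearMap.lsmul 𝒪 V (ℓ : 𝒪)) ≤ L.map ((τ - 1) ^ (ℓ - 1)) := by
  obtain ⟨W, c, d, hW, hcd⟩ := exists_prime_eq_add_mul_pow hℓ
  let t : Module.End 𝒪 L := τ.restrict hL
  have ht : ∀ x : L, ((t x : L) : V) = τ x := fun _ => rfl
  let δ : Module.End 𝒪 L := t - 1
  have hδ : ∀ x : L, ((δ x : L) : V) = (τ - 1 : Module.End 𝒪 V) x := fun _ => rfl
  have hδk : ∀ (k : ℕ) (x : L), (((δ ^ k) x : L) : V) = ((τ - 1 : Module.End 𝒪 V) ^ k) x := by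
    intro k
    induction k with
    | zero => intro x; rfl
    | succ k ih => intro x; rw [pow_succ', pow_succ', Module.End.mul_apply, Module.End.mul_apply,
                     hδ, ih]
  have htk : ∀ (k : ℕ) (x : L), (((t ^ k) x : L) : V) = (τ ^ k) x := by
    intro k
    induction k with
    | zero => intro x; rfl
    | succ k ih => intro x; rw [pow_succ', pow_succ', Module.End.mul_apply, Module.End.mul_apply,
                     ht, ih]
  have ht1 : t ^ ℓ = 1 := by
    ext x
    rw [htk, hτ]; rfl
  -- X · W vanishes at δ because t^ℓ = 1, and the injective factor δ cancels.
  have hWδ : Polynomial.aeval δ W = 0 := by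
    have := congrArg (Polynomial.aeval δ) hW
    simp only [map_mul, map_sub, map_pow, map_add, Polynomial.aeval_X, map_one] at this
    rw [sub_add_cancel, ht1, sub_self] at this
    ext x
    have h2 := congrArg Subtype.val (LinearMap.congr_fun this x)
    rw [Module.End.mul_apply, hδ] at h2
    apply hinj
    rw [h2]
    simp
  rintro _ ⟨x, hx, rfl⟩
  have := congrArg (Polynomial.aeval δ) hcd
  simp only [map_natCast, map_mul, map_add, hWδ, zero_mul, zero_add, map_pow,
    Polynomial.aeval_X] at this
  refine ⟨Polynomial.aeval δ c ⟨x, hx⟩, Subtype.prop _, ?_⟩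
  rw [← hδk, ← Module.End.mul_apply, ← this, LinearMap.lsmul_apply]
  simp [Nat.cast_smul_eq_nsmul]

variable [IsDomain 𝒪] [IsDiscreteValuationRing 𝒪] [IsFractionRing 𝒪 K]

/-- Since (τ - 1)L ⊆ T, the left side is at most the length of L/(τ - 1)^(ℓ-1) L, a quotient of
L/ℓL. -/
theorem mul_relLength_le_of_pow_eq_one {ℓ e : ℕ} (hℓ : ℓ.Prime)
    (he : IsDiscreteValuationRing.addVal 𝒪 (ℓ : 𝒪) = (e : ℕ∞)) {T L : Submodule 𝒪 V}
    [Submodule.IsLattice K L] (hTL : T ≤ L) {τ : Module.End 𝒪 V} (hτ : τ ^ ℓ = 1)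
    (hL : ∀ x ∈ L, τ x ∈ L) (hinj : Function.Injective (τ - 1 : Module.End 𝒪 V))
    (hT : ∀ x ∈ L, τ x - x ∈ T) :
    (ℓ - 1 : ℕ) * relLength T L ≤ e * finrank K V := by
  have h1 : L.map (τ - 1) ≤ T := by
    rintro _ ⟨x, hx, rfl⟩
    exact hT x hx
  have h2 := relLength_map_pow hinj (h1.trans hTL) (ℓ - 1)
  calc (ℓ - 1 : ℕ) * relLength T L ≤ (ℓ - 1 : ℕ) * relLength (L.map (τ - 1)) L := by
        gcongr
        exact relLength_anti h1 hTL
    _ = relLength (L.map ((τ - 1) ^ (ℓ - 1))) L := h2.2.symm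
    _ ≤ relLength (L.map (LinearMap.lsmul 𝒪 V (ℓ : 𝒪))) L :=
        relLength_anti (map_prime_le_map_sub_one_pow hℓ hτ hL hinj) h2.1
    _ = _ := relLength_map_of_addVal (K := K) he L

/-- The discriminant module of an alternating form cannot have length one. -/
theorem two_le_relLength_dualSubmodule [FiniteDimensional K V] {f : LinearMap.BilinForm K V}
    (hf : f.Nondegenerate) (halt : f.IsAlt) {T : Submodule 𝒪 V} [Submodule.IsLattice K T]
    (hne : ¬ f.dualSubmodule T ≤ T) :
    2 ≤ relLength T (f.dualSubmodule T) := by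
  let L := f.dualSubmodule T
  have hLL : f.dualSubmodule L = T := dualSubmodule_dualSubmodule hf halt T
  by_contra hlt
  have h0 : relLength T L ≠ 0 := fun h => hne (relLength_eq_zero_iff.1 h)
  have h1 : relLength T L = 1 := by
    have h2 : relLength T L < 1 + 1 := by rw [one_add_one_eq_two]; exact not_le.1 hlt
    exact le_antisymm (Order.le_of_lt_add_one h2) (Order.one_le_iff_ne_zero.2 h0)
  have hs : IsSimpleModule 𝒪 (L ⧸ T.submoduleOf L) := Module.length_eq_one_iff.1 h1
  have := IsSimpleModule.nontrivial 𝒪 (L ⧸ T.submoduleOf L)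
  obtain ⟨x, hx⟩ := exists_ne (0 : L ⧸ T.submoduleOf L)
  -- Length one gives L = 𝒪x + T. The term f(x, x) vanishes, so f is integral on L and L lies in its
  -- own dual T.
  have hspan := IsSimpleModule.span_singleton_eq_top 𝒪 hx
  obtain ⟨x, rfl⟩ := Submodule.Quotient.mk_surjective _ x
  have hdec : ∀ y ∈ L, ∃ (c : 𝒪) (t : V), t ∈ T ∧ y = c • (x : V) + t := by
    intro y hy
    have : (Submodule.Quotient.mk ⟨y, hy⟩ : L ⧸ T.submoduleOf L) ∈
        Submodule.span 𝒪 {Submodule.Quotient.mk x} := by rw [hspan]; exact Submodule.mem_top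
    obtain ⟨c, hc⟩ := Submodule.mem_span_singleton.1 this
    rw [← Submodule.Quotient.mk_smul, eq_comm, Submodule.Quotient.eq] at hc
    exact ⟨c, _, hc, by simp⟩
  apply hne
  intro y hy
  rw [← hLL]
  intro z hz
  obtain ⟨c, t, ht, rfl⟩ := hdec y hy
  obtain ⟨c', t', ht', rfl⟩ := hdec z hz
  have e : f (c • (x : V) + t) (c' • (x : V) + t') =
      f (c • (x : V) + t) t' - c' • f x t := by
    simp only [map_add, LinearMap.add_apply, LinearMap.map_smul_of_tower, LinearMap.smul_apply,
      halt (x : V), smul_zero, zero_add]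
    rw [← halt.neg_eq (x : V) t, smul_neg]
    abel
  rw [e]
  exact sub_mem (hy t' ht') ((1 : Submodule 𝒪 K).smul_mem _ (x.2 t ht))

end Ramification

theorem isUnit_natCast_of_not_dvd {𝒪 : Type*} [CommRing 𝒪] [IsLocalRing 𝒪] {ℓ : ℕ}
    [CharP (IsLocalRing.ResidueField 𝒪) ℓ] {n : ℕ} (hn : ¬ ℓ ∣ n) : IsUnit (n : 𝒪) := by
  refine (IsLocalRing.residue_ne_zero_iff_isUnit _).1 ?_
  rw [map_natCast]
  exact fun h => hn ((CharP.cast_eq_zero_iff _ ℓ n).1 h)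

/-! ### Fixed vectors and symplectic indecomposability -/

section Invariants

variable {K V G : Type*} [Field K] [AddCommGroup V] [Module K V] [Group G]

/-- The vectors fixed by a subgroup. -/
def Representation.fixedBy (ρ : Representation K G V) (N : Subgroup G) : Submodule K V where
  carrier := {v | ∀ h ∈ N, ρ h v = v}
  add_mem' := fun hx hy h hh => by rw [map_add, hx h hh, hy h hh]
  zero_mem' := fun h _ => map_zero _
  smul_mem' := fun c x hx h hh => by rw [map_smul, hx h hh]

/-- A symplectic form is nondegenerate on the vectors fixed by a finite subgroup. -/
theorem Representation.IsSymplecticForm.restrict_fixedBy_nondegenerate [CharZero K]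
    {ρ : Representation K G V}
    {f : LinearMap.BilinForm K V} (hf : ρ.IsSymplecticForm f) (N : Subgroup G) [Finite N] :
    (f.restrict (ρ.fixedBy N)).Nondegenerate := by
  have := Fintype.ofFinite N
  have halt : (f.restrict (ρ.fixedBy N)).IsAlt := fun x => hf.isAlt x.1
  refine (LinearMap.IsRefl.nondegenerate_iff_separatingLeft
    (LinearMap.BilinForm.IsAlt.isRefl halt)).2 fun x hx => ?_
  apply Subtype.ext
  refine hf.nondegenerate.1 x.1 fun y => ?_
  -- For x fixed by N, pairing with the norm of y gives |N| f(x, y), and |N| is nonzero in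
  -- characteristic 0.
  let z : V := ∑ h : N, ρ h y
  have hz : z ∈ ρ.fixedBy N := by
    intro h hh
    simp only [z, map_sum]
    refine Fintype.sum_equiv (Equiv.mulLeft ⟨h, hh⟩) _ _ fun g => ?_
    simp
  have h1 : f x z = 0 := hx ⟨z, hz⟩
  have h2 : f x z = (Fintype.card N : K) * f x y := by
    simp only [z, map_sum]
    rw [Finset.sum_congr rfl fun (h : N) _ => show f x (ρ h y) = f x y by
      conv_lhs => rw [← x.2 h h.2]
      exact hf.invariant _ _ _]
    simp
  rw [h2] at h1
  exact (mul_eq_zero.1 h1).resolve_left (by simp)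

theorem Representation.fixedBy_stable (ρ : Representation K G V) (N : Subgroup G) [N.Normal]
    (g : G) : ∀ x ∈ ρ.fixedBy N, ρ g x ∈ ρ.fixedBy N := by
  intro x hx h hh
  have h1 := hx _ (Subgroup.Normal.conj_mem inferInstance h hh g⁻¹)
  have h2 : ρ g (ρ (g⁻¹ * h * g⁻¹⁻¹) x) = ρ h (ρ g x) := by
    simp only [← Module.End.mul_apply, ← map_mul]
    congr 2
    group
  rw [← h2, h1]

/-- The representation has no proper nonzero nondegenerate subrepresentation. -/
def Representation.IsSymplecticallyIndecomposable (ρ : Representation K G V) : Prop :=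
  ∀ (f : LinearMap.BilinForm K V) (W : Submodule K V), ρ.IsSymplecticForm f →
    (∀ (g : G), ∀ x ∈ W, ρ g x ∈ W) → (f.restrict W).Nondegenerate → W = ⊥ ∨ W = ⊤

end Invariants

/-! ### Central elements of order ℓ and maximal lattices -/

section Lattices

variable {𝒪 K V G : Type*} [CommRing 𝒪] [IsDomain 𝒪] [IsDiscreteValuationRing 𝒪]
  [Field K] [Algebra 𝒪 K] [IsFractionRing 𝒪 K] [AddCommGroup V] [Module K V]
  [Module 𝒪 V] [IsScalarTower 𝒪 K V] [Group G] [FiniteDimensional K V]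

/-- Version of `hasSelfDualLattice_of_isUnit_card` for the image of the group. -/
theorem Representation.IsSymplecticForm.hasSelfDualLattice_of_isUnit_card_range [Finite G]
    {ρ : Representation K G V} {f : LinearMap.BilinForm K V} (hf : ρ.IsSymplecticForm f)
    (hcard : IsUnit (Nat.card (MonoidHom.toHomUnits ρ).range : 𝒪)) {π : 𝒪} (hπ : Irreducible π)
    {T : Submodule 𝒪 V} (hT : ρ.IsIntegralLattice f T)
    (hkill : ∀ x ∈ f.dualSubmodule T, π • x ∈ T) :
    ρ.HasSelfDualLattice 𝒪 := by
  let Γ := (MonoidHom.toHomUnits ρ).range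
  let ρ' : Representation K Γ V := (Units.coeHom (Module.End K V)).comp Γ.subtype
  have hρ : ∀ γ : Γ, ∃ g : G, ρ' γ = ρ g := by
    rintro ⟨_, g, rfl⟩
    exact ⟨g, rfl⟩
  have hρ' : ∀ g : G, ∃ γ : Γ, ρ' γ = ρ g := fun g => ⟨⟨_, g, rfl⟩, rfl⟩
  have : Finite Γ := Set.finite_range _
  obtain ⟨f', T', hf', hT', hd⟩ :=
    Representation.IsSymplecticForm.hasSelfDualLattice_of_isUnit_card (ρ := ρ') (f := f)
    ⟨hf.nondegenerate, hf.isAlt, fun γ x y => by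
      obtain ⟨g, hg⟩ := hρ γ
      rw [hg]; exact hf.invariant g x y⟩ hcard hπ
    ⟨hT.isLattice, fun γ x hx => by
      obtain ⟨g, hg⟩ := hρ γ
      rw [hg]; exact hT.stable g x hx, hT.le_dual⟩ hkill
  refine ⟨f', T', ⟨hf'.nondegenerate, hf'.isAlt, fun g x y => ?_⟩,
    ⟨hT'.isLattice, fun g x hx => ?_, hT'.le_dual⟩, hd⟩
  · obtain ⟨γ, hγ⟩ := hρ' g
    rw [← hγ]; exact hf'.invariant γ x y
  · obtain ⟨γ, hγ⟩ := hρ' g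
    rw [← hγ]; exact hT'.stable γ x hx

/-- A central element of order `ℓ` acts trivially on the discriminant module of a maximal
integral lattice. -/
theorem Representation.IsSymplecticForm.sub_mem_of_central
    {ρ : Representation K G V} {f : LinearMap.BilinForm K V} (hf : ρ.IsSymplecticForm f)
    {π : 𝒪} {T : Submodule 𝒪 V} (hT : ρ.IsIntegralLattice f T)
    (hmax : ∀ T' : Submodule 𝒪 V, ρ.IsIntegralLattice f T' → T ≤ T' → T' ≤ T)
    (hkill : ∀ x ∈ f.dualSubmodule T, π • x ∈ T) {ℓ : ℕ} (hℓ : ℓ.Prime) (hπℓ : π ∣ (ℓ : 𝒪))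
    {τ : G} (hτ : ρ τ ^ ℓ = 1) (hcent : ∀ g, ρ τ * ρ g = ρ g * ρ τ) :
    ∀ x ∈ f.dualSubmodule T, ρ τ x - x ∈ T := by
  have hlat := hT.isLattice
  let L := f.dualSubmodule T
  have hdual : Submodule.IsLattice K L := isLattice_dualSubmodule hf.nondegenerate T
  have hLs := hf.dual_stable hT.stable
  let D : Module.End K V := ρ τ - 1
  have hDx : ∀ x, D x = ρ τ x - x := fun _ => rfl
  have hDL : ∀ x ∈ L, D x ∈ L := fun x hx => L.sub_mem (hLs τ x hx) hx
  have hDT : ∀ x ∈ T, D x ∈ T := fun x hx => T.sub_mem (hT.stable τ x hx) hx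
  have hDkL : ∀ (k : ℕ), ∀ x ∈ L, (D ^ k) x ∈ L := by
    intro k
    induction k with
    | zero => intro x hx; exact hx
    | succ k ih => intro x hx; rw [pow_succ', Module.End.mul_apply]; exact hDL _ (ih x hx)
  have hDkT : ∀ (k : ℕ), ∀ x ∈ T, (D ^ k) x ∈ T := by
    intro k
    induction k with
    | zero => intro x hx; exact hx
    | succ k ih => intro x hx; rw [pow_succ', Module.End.mul_apply]; exact hDT _ (ih x hx)
  have hDg : ∀ g, Commute D (ρ g) := fun g => (show Commute (ρ τ) (ρ g) from hcent g).sub_left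
    (Commute.one_left _)
  have hDgx : ∀ (k : ℕ) (g : G) x, (D ^ k) (ρ g x) = ρ g ((D ^ k) x) := fun k g x =>
    LinearMap.congr_fun ((hDg g).pow_left k).eq x
  -- the adjoint of `D`
  have hadj : ∀ x y, f (D x) y = - f x (ρ τ⁻¹ (D y)) := by
    intro x y
    rw [hDx, hDx, map_sub, LinearMap.sub_apply, hf.apply_left, map_sub, map_sub,
      Representation.inv_self_apply]
    abel
  have hadjk : ∀ (k : ℕ) x y, f ((D ^ k) x) y = (-1) ^ k * f x (ρ (τ⁻¹ ^ k) ((D ^ k) y)) := by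
    intro k
    induction k with
    | zero => intro x y; simp
    | succ k ih =>
      intro x y
      rw [pow_succ', Module.End.mul_apply, hadj, ih, ← pow_succ' D k, pow_succ D k, Module.End.mul_apply, hDgx]
      rw [← Module.End.mul_apply (ρ (τ⁻¹ ^ k)), ← map_mul, ← pow_succ, pow_succ' (-1 : K)]
      ring
  -- `D` is nilpotent modulo the lattice
  have hnil : ∀ x ∈ L, (D ^ ℓ) x ∈ T := by
    let t : Module.End 𝒪 L := ((ρ τ).restrictScalars 𝒪).restrict (hLs τ)
    have ht : ∀ x : L, ((t x : L) : V) = ρ τ x := fun _ => rfl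
    have htk : ∀ (k : ℕ) (x : L), (((t ^ k) x : L) : V) = (ρ τ ^ k) x := by
      intro k
      induction k with
      | zero => intro x; rfl
      | succ k ih => intro x; rw [pow_succ', pow_succ', Module.End.mul_apply,
                       Module.End.mul_apply, ht, ih]
    have ht1 : t ^ ℓ = 1 := by
      ext x
      rw [htk, hτ]; rfl
    let δ : Module.End 𝒪 L := t - 1
    have hδ : ∀ x : L, ((δ x : L) : V) = D x := fun _ => rfl
    have hδk : ∀ (k : ℕ) (x : L), (((δ ^ k) x : L) : V) = (D ^ k) x := by
      intro k
      induction k with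
      | zero => intro x; rfl
      | succ k ih => intro x; rw [pow_succ', pow_succ', Module.End.mul_apply,
                       Module.End.mul_apply, hδ, ih]
    -- Expanding (δ + 1)^ℓ = 1 shows that δ^ℓ is divisible by ℓ, hence by π, and πL ⊆ T.
    obtain ⟨r, hr⟩ := Commute.exists_add_pow_prime_eq hℓ (Commute.one_right δ)
    rw [sub_add_cancel, ht1, one_pow, mul_one, mul_assoc] at hr
    intro x hx
    obtain ⟨c, hc⟩ := hπℓ
    have h1 : δ ^ ℓ = - ((ℓ : Module.End 𝒪 L) * (δ * r)) := by
      rw [add_right_comm] at hr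
      exact eq_neg_of_add_eq_zero_left (left_eq_add.1 (by rw [add_comm]; exact hr))
    have h2 := hδk ℓ ⟨x, hx⟩
    rw [h1] at h2
    rw [show (D ^ ℓ) x = (D ^ ℓ) ((⟨x, hx⟩ : L) : V) from rfl, ← h2]
    have h3 : ((ℓ : Module.End 𝒪 L) * (δ * r)) ⟨x, hx⟩ = π • c • (δ * r) ⟨x, hx⟩ := by
      rw [Module.End.mul_apply, smul_smul, ← hc, Nat.cast_smul_eq_nsmul]
      simp
    rw [LinearMap.neg_apply, h3]
    exact T.neg_mem (hkill _ (Subtype.prop (c • (δ * r) ⟨x, hx⟩)))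
  -- isotropy argument
  have key : ∀ m : ℕ, (∀ x ∈ L, (D ^ (m + 1)) x ∈ T) → ∀ x ∈ L, D x ∈ T := by
    intro m
    induction m with
    | zero => intro hm; simpa using hm
    | succ m ih =>
      intro hm
      apply ih
      -- T' is stable because D commutes with G. The adjoint of D is -τ⁻¹D, so pairing two vectors
      -- of D^(m+1) L brings in D^(2m+2) L. As 2m + 2 ≥ m + 2, T' is integral, and maximality lowers
      -- the exponent.
      let E : V →ₗ[𝒪] V := (D ^ (m + 1)).restrictScalars 𝒪
      let T' : Submodule 𝒪 V := T ⊔ L.map E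
      have hT'le : T' ≤ L := by
        refine sup_le hT.le_dual ?_
        rintro _ ⟨x, hx, rfl⟩
        exact hDkL _ x hx
      have key := hmax T' ⟨?_, ?_, ?_⟩ le_sup_left
      · intro x hx
        exact key (Submodule.mem_sup_right ⟨x, hx, rfl⟩)
      · exact Submodule.IsLattice.of_le_of_isLattice_of_fg K le_sup_left
          (hlat.fg.sup (hdual.fg.map _))
      · intro g x hx
        have : T' ≤ T'.comap ((ρ g).restrictScalars 𝒪) := by
          refine sup_le (fun y hy => Submodule.mem_sup_left (hT.stable g y hy)) ?_
          rintro _ ⟨y, hy, rfl⟩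
          exact Submodule.mem_sup_right ⟨ρ g y, hLs g y hy, hDgx _ g y⟩
        exact this hx
      · refine sup_le (fun t ht y hy => ?_) ?_
        · have := hT'le hy t ht
          rwa [← hf.isAlt.neg_eq, neg_mem_iff] at this
        · rintro _ ⟨x, hx, rfl⟩ y hy
          obtain ⟨t, ht, _, ⟨z, hz, rfl⟩, rfl⟩ := Submodule.mem_sup.1 hy
          rw [map_add]
          refine add_mem (hDkL _ x hx t ht) ?_
          change f ((D ^ (m + 1)) x) ((D ^ (m + 1)) z) ∈ _
          have e : (D ^ (m + 1)) ((D ^ (m + 1)) z) = (D ^ m) ((D ^ (m + 1 + 1)) z) := by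
            rw [← Module.End.mul_apply, ← Module.End.mul_apply, ← pow_add, ← pow_add]
            congr 2
            omega
          rw [hadjk, e]
          have h1 : f x (ρ (τ⁻¹ ^ (m + 1)) ((D ^ m) ((D ^ (m + 1 + 1)) z)))
              ∈ (1 : Submodule 𝒪 K) :=
            hx _ (hT.stable _ _ (hDkT _ _ (hm z hz)))
          rcases neg_one_pow_eq_or K (m + 1) with h | h
          · rw [h, one_mul]; exact h1
          · rw [h, neg_one_mul, neg_mem_iff]; exact h1
  have h1 := key (ℓ - 1) (by rw [Nat.sub_add_cancel hℓ.pos]; exact hnil)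
  exact h1

end Lattices

/-- A normal `p`-subgroup acting trivially on a nonzero quotient of stable lattices acts trivially
on an indecomposable representation. -/
theorem Representation.IsSymplecticForm.eq_one_of_trivial_on_quotient
    {𝒪 K V G : Type*} [CommRing 𝒪] [Field K] [CharZero K] [AddCommGroup V] [Module K V]
    [Module 𝒪 V] [Group G] [Finite G] {ρ : Representation K G V} {f : LinearMap.BilinForm K V} (hf : ρ.IsSymplecticForm f)
    (hind : ρ.IsSymplecticallyIndecomposable) {T L : Submodule 𝒪 V}
    (hLT : ¬ L ≤ T) (N : Subgroup G) [N.Normal]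
    (hN : IsUnit (Nat.card N : 𝒪)) (htriv : ∀ h ∈ N, ∀ x ∈ L, ρ h x - x ∈ T) :
    ∀ h ∈ N, ρ h = 1 := by
  have := Fintype.ofFinite N
  obtain ⟨x, hxL, hxT⟩ := SetLike.not_le_iff_exists.1 hLT
  let z : V := ∑ h : N, ρ h x
  have hz : z ∈ ρ.fixedBy N := by
    intro h hh
    simp only [z, map_sum]
    refine Fintype.sum_equiv (Equiv.mulLeft ⟨h, hh⟩) _ _ fun g => ?_
    simp
  -- Modulo T the norm z is |N| x, which is nonzero because |N| is a unit.
  have hz0 : z ≠ 0 := by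
    intro h0
    have h1 : ∑ h : N, (ρ h x - x) ∈ T := sum_mem fun h _ => htriv h h.2 x hxL
    rw [Finset.sum_sub_distrib] at h1
    change z - _ ∈ T at h1
    rw [h0, zero_sub, neg_mem_iff, Finset.sum_const, Finset.card_univ,
      ← Nat.card_eq_fintype_card, ← Nat.cast_smul_eq_nsmul 𝒪] at h1
    obtain ⟨u, hu⟩ := hN
    rw [← hu] at h1
    have h2 := T.smul_mem (↑u⁻¹ : 𝒪) h1
    rw [smul_smul, Units.inv_mul, one_smul] at h2
    exact hxT h2
  rcases hind f (ρ.fixedBy N) hf (ρ.fixedBy_stable N) (hf.restrict_fixedBy_nondegenerate N)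
    with h | h
  · rw [h, Submodule.mem_bot] at hz
    exact absurd hz hz0
  · intro g hg
    ext v
    have : v ∈ ρ.fixedBy N := by rw [h]; exact Submodule.mem_top
    exact this g hg

/-! ### The indecomposable case -/

section Indecomposable

variable {𝒪 K V G : Type*} [CommRing 𝒪] [IsDomain 𝒪] [IsDiscreteValuationRing 𝒪]
  [Field K] [CharZero K] [Algebra 𝒪 K] [IsFractionRing 𝒪 K] [AddCommGroup V] [Module K V]
  [Module 𝒪 V] [IsScalarTower 𝒪 K V] [Group G] [Finite G] [FiniteDimensional K V]

/-- The action of `G` on the quotient of two stable lattices. -/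
noncomputable def Representation.onQuotient (ρ : Representation K G V) (T L : Submodule 𝒪 V)
    (hT : ∀ (g : G), ∀ x ∈ T, ρ g x ∈ T) (hL : ∀ (g : G), ∀ x ∈ L, ρ g x ∈ L) :
    G →* Module.End 𝒪 (L ⧸ T.submoduleOf L) where
  toFun g := Submodule.mapQ _ _ (((ρ g).restrictScalars 𝒪).restrict (hL g)) fun x hx => hT g x hx
  map_one' := by
    ext x
    change Submodule.Quotient.mk _ = Submodule.Quotient.mk x
    congr 1
    exact Subtype.ext (LinearMap.congr_fun (map_one ρ) (x : V))
  map_mul' g h := by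
    ext x
    change Submodule.Quotient.mk _ = Submodule.Quotient.mk _
    congr 1
    exact Subtype.ext (LinearMap.congr_fun (map_mul ρ g h) (x : V))

variable {p ℓ e : ℕ}

/-- The main theorem for indecomposable symplectic representations. -/
theorem Representation.IsSymplecticForm.hasSelfDualLattice_of_indecomposable
    {ρ : Representation K G V} {f₀ : LinearMap.BilinForm K V} (hf₀ : ρ.IsSymplecticForm f₀)
    (hind : ρ.IsSymplecticallyIndecomposable) (hp : p.Prime) (hℓ : ℓ.Prime) (hpℓ : ℓ ≠ p)
    [CharP (IsLocalRing.ResidueField 𝒪) ℓ] (H : Subgroup G) [H.Normal] (hH : IsPGroup p H)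
    (hcyc : IsCyclic (G ⧸ H)) (he : IsDiscreteValuationRing.addVal 𝒪 (ℓ : 𝒪) = (e : ℕ∞))
    (he1 : 1 ≤ e) (hn : finrank K V * e < 2 * (ℓ - 1)) :
    ρ.HasSelfDualLattice 𝒪 := by
  obtain ⟨π, hπ⟩ := IsDiscreteValuationRing.exists_irreducible 𝒪
  obtain ⟨f, T, hf, hT, hmax, hkill, hlen⟩ := hf₀.exists_minimal_isIntegralLattice hπ
  have hlat := hT.isLattice
  let L := f.dualSubmodule T
  have hdual : Submodule.IsLattice K L := isLattice_dualSubmodule hf.nondegenerate T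
  have hLs := hf.dual_stable hT.stable
  by_cases hLT : L ≤ T
  · exact ⟨f, T, hf, hT, hLT⟩
  have : Fact p.Prime := ⟨hp⟩
  have hpO : IsUnit (p : 𝒪) := isUnit_natCast_of_not_dvd (ℓ := ℓ) fun h =>
    hpℓ ((Nat.prime_dvd_prime_iff_eq hℓ hp).1 h)
  obtain ⟨r, hr⟩ := ENat.ne_top_iff_exists.1 (relLength_ne_top (K := K) hT.le_dual)
  have hr2 : 2 * r ≤ finrank K V := by
    rw [← hr] at hlen
    exact_mod_cast hlen
  have hrℓ : r + 1 < ℓ := by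
    have h1 : finrank K V ≤ finrank K V * e := Nat.le_mul_of_pos_right _ he1
    omega
  -- an `ℓ`-element generating the `ℓ`-part modulo `H`
  obtain ⟨g₀, hg₀⟩ := hcyc.exists_generator
  obtain ⟨g₀, rfl⟩ := QuotientGroup.mk_surjective g₀
  have hgen : ∀ x : G, ∃ (i : ℤ) (h : G), h ∈ H ∧ x = g₀ ^ i * h := by
    intro x
    obtain ⟨i, hi⟩ := Subgroup.mem_zpowers_iff.1 (hg₀ x)
    refine ⟨i, (g₀ ^ i)⁻¹ * x, ?_, by group⟩
    exact QuotientGroup.eq.1 (by rw [← hi]; rfl)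
  obtain ⟨s, m, hm, hord⟩ := Nat.exists_eq_pow_mul_and_not_dvd (orderOf_pos g₀).ne' ℓ hℓ.ne_one
  let σ := g₀ ^ m
  have hσ : σ ^ ℓ ^ s = 1 := by
    rw [← pow_mul, mul_comm, ← hord, pow_orderOf_eq_one]
  let θ := ρ.onQuotient T L hT.stable hLs
  have hθ : ∀ g (x : L), θ g (Submodule.Quotient.mk x) =
      Submodule.Quotient.mk ⟨ρ g x, hLs g x x.2⟩ := fun _ _ => rfl
  have hcomm : ∀ h ∈ H, θ σ * θ h = θ h * θ σ := by
    intro h hh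
    refine commute_of_isPGroup_of_length hp hℓ hpℓ hpO ?_ ?_ θ H hH hσ hh
    · intro c hc x
      obtain ⟨x, rfl⟩ := Submodule.Quotient.mk_surjective _ x
      rw [hπ.maximalIdeal_eq, Ideal.mem_span_singleton] at hc
      obtain ⟨c, rfl⟩ := hc
      rw [← Submodule.Quotient.mk_smul, Submodule.Quotient.mk_eq_zero, mul_comm, mul_smul]
      exact T.smul_mem _ (hkill x x.2)
    · have : Module.length 𝒪 (L ⧸ T.submoduleOf L) = r := hr.symm
      rw [this]
      exact_mod_cast hrℓ
  -- The commutators of σ with H land in N. Once N is known to act trivially on V, commutation on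
  -- L/T lifts to V.
  let N : Subgroup G := H ⊓ θ.ker
  have hNtriv : ∀ h ∈ N, ρ h = 1 := by
    refine hf.eq_one_of_trivial_on_quotient hind hLT N ?_ ?_
    · have hNp : IsPGroup p N := hH.to_le inf_le_left
      obtain ⟨a, ha⟩ := IsPGroup.iff_card.1 hNp
      rw [ha]
      push_cast
      exact hpO.pow a
    · intro h hh x hx
      have h1 : θ h (Submodule.Quotient.mk ⟨x, hx⟩) = Submodule.Quotient.mk ⟨x, hx⟩ := by
        rw [MonoidHom.mem_ker.1 hh.2]; rfl
      rw [hθ, Submodule.Quotient.eq] at h1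
      exact h1
  have hcH : ∀ h ∈ H, ρ σ * ρ h = ρ h * ρ σ := by
    intro h hh
    have h1 : ⁅σ, h⁆ ∈ N := by
      refine ⟨?_, ?_⟩
      · rw [commutatorElement_def]
        exact H.mul_mem (Subgroup.Normal.conj_mem inferInstance h hh σ) (H.inv_mem hh)
      · change ⁅σ, h⁆ ∈ θ.ker
        rw [MonoidHom.mem_ker]
        have h3 : ⁅σ, h⁆ = σ * h * (h * σ)⁻¹ := by rw [commutatorElement_def]; group
        rw [h3, map_mul, map_mul, hcomm h hh, ← map_mul, ← map_mul, mul_inv_cancel, map_one]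
    have h2 := hNtriv _ h1
    have h3 : ⁅σ, h⁆ * (h * σ) = σ * h := by rw [commutatorElement_def]; group
    rw [← map_mul, ← h3, map_mul, h2, one_mul, map_mul]
  have hcent : ∀ g, ρ σ * ρ g = ρ g * ρ σ := by
    intro g
    obtain ⟨i, h, hh, rfl⟩ := hgen g
    have h1 : Commute (ρ σ) (ρ (g₀ ^ i)) := by
      rw [Commute, SemiconjBy, ← map_mul, ← map_mul]
      congr 1
      exact ((Commute.refl g₀).pow_left m).zpow_right i
    rw [map_mul]
    exact h1.mul_right (hcH h hh)
  by_cases hσ1 : ρ σ = 1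
  · -- the image of `G` has order prime to `ℓ`
    refine hf.hasSelfDualLattice_of_isUnit_card_range (𝒪 := 𝒪) ?_ hπ hT hkill
    refine isUnit_natCast_of_not_dvd (ℓ := ℓ) fun hdvd => ?_
    have : Fact ℓ.Prime := ⟨hℓ⟩
    have : Finite (MonoidHom.toHomUnits ρ).range := Set.finite_range _
    obtain ⟨⟨_, x, rfl⟩, hx⟩ := exists_prime_orderOf_dvd_card' ℓ hdvd
    let y : (Module.End K V)ˣ := MonoidHom.toHomUnits ρ x
    have hy : orderOf y = ℓ := by
      rw [← hx, ← Subgroup.orderOf_coe]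
    obtain ⟨a, ha⟩ := IsPGroup.iff_card.1 hH
    obtain ⟨i, hi⟩ := Subgroup.mem_zpowers_iff.1 (hg₀ x)
    -- As σ acts trivially, y^m is the image of an element of the p-group H. An element y of order ℓ
    -- would then force ℓ to divide m p^a.
    have hxm : (σ ^ i)⁻¹ * x ^ m ∈ H := by
      refine QuotientGroup.eq.1 ?_
      rw [QuotientGroup.mk_pow, ← hi, QuotientGroup.mk_zpow, QuotientGroup.mk_pow, ← zpow_natCast,
        ← zpow_natCast, ← zpow_mul, ← zpow_mul, mul_comm]
    have hσu : MonoidHom.toHomUnits ρ σ = 1 := Units.ext hσ1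
    have hyh : y ^ m = MonoidHom.toHomUnits ρ ((σ ^ i)⁻¹ * x ^ m) := by
      rw [map_mul, map_inv, map_zpow, hσu, one_zpow, inv_one, one_mul, map_pow]
    have hpa : ((σ ^ i)⁻¹ * x ^ m) ^ p ^ a = 1 := by
      have := pow_card_eq_one' (x := (⟨_, hxm⟩ : H))
      rw [ha] at this
      exact congrArg Subtype.val this
    have hy1 : y ^ (m * p ^ a) = 1 := by
      rw [pow_mul, hyh, ← map_pow, hpa, map_one]
    have hd : ℓ ∣ m * p ^ a := hy ▸ orderOf_dvd_of_pow_eq_one hy1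
    rcases hℓ.dvd_mul.1 hd with h | h
    · exact hm h
    · exact hpℓ ((Nat.prime_dvd_prime_iff_eq hℓ hp).1 (hℓ.dvd_of_dvd_pow h))
  · -- a central element of order `ℓ` without fixed vectors
    exfalso
    classical
    -- The least such k is positive; stopping one step earlier gives τ whose image has order exactly
    -- ℓ.
    have hex : ∃ k, ρ (σ ^ ℓ ^ k) = 1 := ⟨s, by rw [hσ, map_one]⟩
    obtain ⟨j, hj⟩ : ∃ j, Nat.find hex = j + 1 := by
      refine Nat.exists_eq_succ_of_ne_zero fun h0 => hσ1 ?_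
      have := Nat.find_spec hex
      rwa [h0, pow_zero, pow_one] at this
    let τ := σ ^ ℓ ^ j
    have hτ1 : ρ τ ≠ 1 := Nat.find_min hex (m := j) (by omega)
    have hτℓ : ρ τ ^ ℓ = 1 := by
      have := Nat.find_spec hex
      rwa [hj, pow_succ, pow_mul, map_pow] at this
    have hτc : ∀ g, ρ τ * ρ g = ρ g * ρ τ := fun g => by
      rw [map_pow]
      exact (show Commute (ρ σ) (ρ g) from hcent g).pow_left _
    -- Only ρ τ is known to be central, so normality of the subgroup generated by τ is not available
    -- and stability is checked directly.
    have hfix : ρ.fixedBy (Subgroup.zpowers τ) = ⊥ := by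
      refine (hind f (ρ.fixedBy (Subgroup.zpowers τ)) hf (fun g x hx h hh => ?_)
        (hf.restrict_fixedBy_nondegenerate (Subgroup.zpowers τ))).resolve_right fun htop => hτ1 ?_
      · obtain ⟨i, rfl⟩ := Subgroup.mem_zpowers_iff.1 hh
        have h1 : Commute (MonoidHom.toHomUnits ρ τ) (MonoidHom.toHomUnits ρ g) :=
          Units.ext (hτc g)
        have h2 := h1.zpow_left i
        rw [← map_zpow] at h2
        have h3 : ρ (τ ^ i) * ρ g = ρ g * ρ (τ ^ i) := congrArg Units.val h2.eq
        rw [← Module.End.mul_apply, h3, Module.End.mul_apply, hx _ hh]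
      · ext v
        have hv : v ∈ ρ.fixedBy (Subgroup.zpowers τ) := by rw [htop]; exact Submodule.mem_top
        exact hv τ (Subgroup.mem_zpowers τ)
    have hinj : Function.Injective
        ((ρ τ).restrictScalars 𝒪 - 1 : Module.End 𝒪 V) := by
      rw [← LinearMap.ker_eq_bot, LinearMap.ker_eq_bot']
      intro v hv
      have hv' : MonoidHom.toHomUnits ρ τ • v = v := sub_eq_zero.1 hv
      have : v ∈ ρ.fixedBy (Subgroup.zpowers τ) := by
        intro h hh
        obtain ⟨i, rfl⟩ := Subgroup.mem_zpowers_iff.1 hh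
        have h1 : MonoidHom.toHomUnits ρ (τ ^ i) • v = v := by
          rw [map_zpow]
          exact (MulAction.stabilizer _ v).zpow_mem (MulAction.mem_stabilizer_iff.2 hv') i
        exact h1
      rwa [hfix, Submodule.mem_bot] at this
    have hπℓ : π ∣ (ℓ : 𝒪) := by
      rw [← IsDiscreteValuationRing.addVal_le_iff_dvd, IsDiscreteValuationRing.addVal_uniformizer hπ,
        he]
      exact_mod_cast he1
    have hsub := hf.sub_mem_of_central hT hmax hkill hℓ hπℓ hτℓ hτc
    have hτO : ((ρ τ).restrictScalars 𝒪 : Module.End 𝒪 V) ^ ℓ = 1 := by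
      have : ∀ (k : ℕ) (v : V), (((ρ τ).restrictScalars 𝒪 : Module.End 𝒪 V) ^ k) v
          = (ρ τ ^ k) v := by
        intro k
        induction k with
        | zero => intro v; rfl
        | succ k ih => intro v; rw [pow_succ', pow_succ', Module.End.mul_apply,
                         Module.End.mul_apply, ih]; rfl
      ext v
      rw [this, hτℓ]; rfl
    have h1 := mul_relLength_le_of_pow_eq_one (K := K) hℓ he hT.le_dual hτO (hLs τ) hinj hsub
    have h2 := two_le_relLength_dualSubmodule hf.nondegenerate hf.isAlt (T := T) hLT
    rw [← hr] at h1 h2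
    have h1' : (ℓ - 1) * r ≤ e * finrank K V := by exact_mod_cast h1
    have h2' : 2 ≤ r := by exact_mod_cast h2
    have h3 : (ℓ - 1) * 2 ≤ (ℓ - 1) * r := Nat.mul_le_mul_left _ h2'
    rw [mul_comm e] at h1'
    omega

end Indecomposable

/-! ### Orthogonal sums -/

section Splitting

variable {𝒪 K V G : Type*} [CommRing 𝒪] [Field K] [Algebra 𝒪 K] [AddCommGroup V] [Module K V]
  [Module 𝒪 V] [IsScalarTower 𝒪 K V] [Group G]

/-- Self-dual lattices of two complementary subrepresentations can be added. -/
theorem Representation.HasSelfDualLattice.of_isCompl {ρ : Representation K G V}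
    {W W' : Submodule K V} (hc : IsCompl W W') (hW : ∀ g, W ≤ W.comap (ρ g))
    (hW' : ∀ g, W' ≤ W'.comap (ρ g))
    (h : (ρ.subrepresentation W hW).HasSelfDualLattice 𝒪)
    (h' : (ρ.subrepresentation W' hW').HasSelfDualLattice 𝒪) : ρ.HasSelfDualLattice 𝒪 := by
  obtain ⟨f, T, hf, hT, hd⟩ := h
  obtain ⟨f', T', hf', hT', hd'⟩ := h'
  have hlat := hT.isLattice
  have hlat' := hT'.isLattice
  let q : V →ₗ[K] W := Submodule.projectionOnto W W' hc
  let q' : V →ₗ[K] W' := Submodule.projectionOnto W' W hc.symm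
  have hqq : ∀ x, (q x : V) + (q' x : V) = x := fun x =>
    Submodule.projection_add_projection_eq_self hc x
  have hqW : ∀ w : W, q w = w := fun w => Submodule.projectionOnto_apply_left hc w
  have hq'W' : ∀ w : W', q' w = w := fun w => Submodule.projectionOnto_apply_left hc.symm w
  have hqW' : ∀ w : W', q w = 0 := fun w => Submodule.projectionOnto_apply_right hc w
  have hq'W : ∀ w : W, q' w = 0 := fun w => Submodule.projectionOnto_apply_right hc.symm w
  have hqg : ∀ g x, q (ρ g x) = ρ.subrepresentation W hW g (q x) := by
    intro g x
    have h1 : ρ g x = ((ρ.subrepresentation W hW g (q x) : W) : V) +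
        ((ρ.subrepresentation W' hW' g (q' x) : W') : V) := by
      conv_lhs => rw [← hqq x, map_add]
      rfl
    rw [h1, map_add, hqW, hqW', add_zero]
  have hq'g : ∀ g x, q' (ρ g x) = ρ.subrepresentation W' hW' g (q' x) := by
    intro g x
    have h1 : ρ g x = ((ρ.subrepresentation W hW g (q x) : W) : V) +
        ((ρ.subrepresentation W' hW' g (q' x) : W') : V) := by
      conv_lhs => rw [← hqq x, map_add]
      rfl
    rw [h1, map_add, hq'W, hq'W', zero_add]
  let F : LinearMap.BilinForm K V := f.compl₁₂ q q + f'.compl₁₂ q' q'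
  have hF : ∀ x y, F x y = f (q x) (q y) + f' (q' x) (q' y) := fun x y => rfl
  let S : Submodule 𝒪 V := T.map (W.subtype.restrictScalars 𝒪) ⊔
    T'.map (W'.subtype.restrictScalars 𝒪)
  have hS : ∀ x, x ∈ S ↔ q x ∈ T ∧ q' x ∈ T' := by
    intro x
    constructor
    · intro hx
      obtain ⟨_, ⟨t, ht, rfl⟩, _, ⟨t', ht', rfl⟩, rfl⟩ := Submodule.mem_sup.1 hx
      change q ((t : V) + (t' : V)) ∈ T ∧ q' ((t : V) + (t' : V)) ∈ T'
      rw [map_add, map_add, hqW, hqW', hq'W, hq'W', add_zero, zero_add]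
      exact ⟨ht, ht'⟩
    · rintro ⟨h1, h2⟩
      rw [← hqq x]
      exact add_mem (Submodule.mem_sup_left ⟨_, h1, rfl⟩) (Submodule.mem_sup_right ⟨_, h2, rfl⟩)
  have hST : ∀ t ∈ T, (t : V) ∈ S := fun t ht => Submodule.mem_sup_left ⟨t, ht, rfl⟩
  have hST' : ∀ t ∈ T', (t : V) ∈ S := fun t ht => Submodule.mem_sup_right ⟨t, ht, rfl⟩
  have halt : F.IsAlt := fun x => by rw [hF, hf.isAlt, hf'.isAlt, add_zero]
  refine ⟨F, S, ⟨?_, halt, fun g x y => ?_⟩, ⟨⟨?_, ?_⟩, fun g x hx => ?_, fun x hx y hy => ?_⟩,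
    fun x hx => ?_⟩
  · refine (LinearMap.IsRefl.nondegenerate_iff_separatingLeft
      (LinearMap.BilinForm.IsAlt.isRefl halt)).2 fun x hx => ?_
    have h1 : q x = 0 := hf.nondegenerate.1 _ fun w => by
      have := hx w
      rwa [hF, hqW, hq'W, map_zero, add_zero] at this
    have h2 : q' x = 0 := hf'.nondegenerate.1 _ fun w => by
      have := hx w
      rwa [hF, hqW', hq'W', map_zero, zero_add] at this
    rw [← hqq x, h1, h2]; simp
  · rw [hF, hqg, hqg, hq'g, hq'g, hf.invariant, hf'.invariant, hF]
  · exact (hlat.fg.map _).sup (hlat'.fg.map _)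
  · have key : ∀ (U : Submodule K V) (R : Submodule 𝒪 U), Submodule.span K (R : Set U) = ⊤ →
        (∀ t ∈ R, (t : V) ∈ S) → U ≤ Submodule.span K (S : Set V) := by
      intro U R hR hRS
      have : (⊤ : Submodule K U) ≤ (Submodule.span K (S : Set V)).comap U.subtype := by
        rw [← hR, Submodule.span_le]
        exact fun t ht => Submodule.subset_span (hRS t ht)
      exact fun x hx => this (Submodule.mem_top (x := ⟨x, hx⟩))
    rw [eq_top_iff, ← hc.sup_eq_top]
    exact sup_le (key W T hlat.span_eq_top hST) (key W' T' hlat'.span_eq_top hST')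
  · rw [hS] at hx ⊢
    rw [hqg, hq'g]
    exact ⟨hT.stable g _ hx.1, hT'.stable g _ hx.2⟩
  · rw [hS] at hx hy
    rw [hF]
    exact add_mem (hT.le_dual hx.1 _ hy.1) (hT'.le_dual hx.2 _ hy.2)
  · rw [hS]
    refine ⟨hd fun t ht => ?_, hd' fun t ht => ?_⟩
    · have := hx t (hST t ht)
      rwa [hF, hqW, hq'W, map_zero, add_zero] at this
    · have := hx t (hST' t ht)
      rwa [hF, hqW', hq'W', map_zero, zero_add] at this

theorem Representation.IsSymplecticForm.subrepresentation {ρ : Representation K G V}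
    {f : LinearMap.BilinForm K V} (hf : ρ.IsSymplecticForm f) (W : Submodule K V)
    (hW : ∀ g, W ≤ W.comap (ρ g)) (hnd : (f.restrict W).Nondegenerate) :
    (ρ.subrepresentation W hW).IsSymplecticForm (f.restrict W) :=
  ⟨hnd, fun x => hf.isAlt x.1, fun g x y => hf.invariant g x.1 y.1⟩

end Splitting

/-! ### Reduction to the indecomposable case -/

section Main

universe u

variable {𝒪 K G : Type*} [CommRing 𝒪] [IsDomain 𝒪] [IsDiscreteValuationRing 𝒪]
  [Field K] [CharZero K] [Algebra 𝒪 K] [IsFractionRing 𝒪 K] [Group G] [Finite G] {p ℓ e : ℕ}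

/-- Symplectic representations of small dimension of groups of inertia type have self-dual
lattices. -/
theorem Representation.IsSymplecticForm.hasSelfDualLattice
    (hp : p.Prime) (hℓ : ℓ.Prime) (hpℓ : ℓ ≠ p)
    [CharP (IsLocalRing.ResidueField 𝒪) ℓ] (H : Subgroup G) [H.Normal] (hH : IsPGroup p H)
    (hcyc : IsCyclic (G ⧸ H)) (he : IsDiscreteValuationRing.addVal 𝒪 (ℓ : 𝒪) = (e : ℕ∞))
    (he1 : 1 ≤ e) (n : ℕ) :
    ∀ (V : Type u) [AddCommGroup V] [Module K V] [Module 𝒪 V] [IsScalarTower 𝒪 K V]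
      [FiniteDimensional K V] (ρ : Representation K G V) (f : LinearMap.BilinForm K V),
      ρ.IsSymplecticForm f → finrank K V = n → finrank K V * e < 2 * (ℓ - 1) →
      ρ.HasSelfDualLattice 𝒪 := by
  induction n using Nat.strong_induction_on with
  | _ n ih =>
  intro V _ _ _ _ _ ρ f hf hVn hn
  by_cases hind : ρ.IsSymplecticallyIndecomposable
  · exact hf.hasSelfDualLattice_of_indecomposable hind hp hℓ hpℓ H hH hcyc he he1 hn
  · unfold Representation.IsSymplecticallyIndecomposable at hind
    push Not at hind
    -- The form that exhibits the splitting may differ from the given one. This is harmless, since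
    -- the conclusion allows any symplectic form.
    obtain ⟨f, W, hf, hW, hnd, hbot, htop⟩ := hind
    have hrefl := LinearMap.BilinForm.IsAlt.isRefl hf.isAlt
    let W' := f.orthogonal W
    have hc : IsCompl W W' :=
      LinearMap.BilinForm.isCompl_orthogonal_of_restrict_nondegenerate hrefl hnd
    have hW' : ∀ g, W' ≤ W'.comap (ρ g) := by
      intro g x hx w hw
      have h1 := hx (ρ g⁻¹ w) (hW g⁻¹ w hw)
      change f (ρ g⁻¹ w) x = 0 at h1
      change f w (ρ g x) = 0
      rw [hf.apply_left, inv_inv] at h1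
      exact h1
    have hnd' : (f.restrict W').Nondegenerate := by
      refine LinearMap.BilinForm.nondegenerate_restrict_of_disjoint_orthogonal f hrefl ?_
      rw [LinearMap.BilinForm.orthogonal_orthogonal hf.nondegenerate hrefl]
      exact hc.symm.disjoint
    have hlt : finrank K W < finrank K V := Submodule.finrank_lt htop
    have hlt' : finrank K W' < finrank K V := Submodule.finrank_lt fun h => hbot <| by
      have := hc.disjoint
      rw [h] at this
      exact disjoint_top.1 this
    exact Representation.HasSelfDualLattice.of_isCompl hc hW hW'
      (ih _ (hVn ▸ hlt) W _ _ (hf.subrepresentation W hW hnd) rfl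
        (lt_of_le_of_lt (Nat.mul_le_mul_right _ hlt.le) hn))
      (ih _ (hVn ▸ hlt') W' _ _ (hf.subrepresentation W' hW' hnd') rfl
        (lt_of_le_of_lt (Nat.mul_le_mul_right _ hlt'.le) hn))

end Main

/-! ### Symplectic bases over a principal ideal domain -/

section SymplecticBasis

universe u

variable {R : Type*} [CommRing R]

/-- Two families that pair to a symplectic Gram matrix and span a module form a basis. -/
theorem exists_basis_toMatrix_eq_J {M : Type*} [AddCommGroup M] [Module R M] {m : ℕ}
    (f : LinearMap.BilinForm R M) (hf : f.IsAlt) (u w : Fin m → M)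
    (huu : ∀ i j, f (u i) (u j) = 0) (hww : ∀ i j, f (w i) (w j) = 0)
    (hwu : ∀ i j, f (w i) (u j) = if i = j then 1 else 0)
    (hsp : Submodule.span R (Set.range u ∪ Set.range w) = ⊤) :
    ∃ b : Basis (Fin m ⊕ Fin m) R M, LinearMap.BilinForm.toMatrix b f = Matrix.J (Fin m) R := by
  have huw : ∀ i j, f (u i) (w j) = -if i = j then 1 else 0 := by
    intro i j
    rw [← hf.neg_eq (w j) (u i), hwu]
    simp only [eq_comm]
  have hli : LinearIndependent R (Sum.elim u w) := by
    rw [Fintype.linearIndependent_iff]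
    intro c hc
    have h1 : ∀ z, ∑ i, c (Sum.inl i) * f (u i) z + ∑ i, c (Sum.inr i) * f (w i) z = 0 := by
      intro z
      have := congrArg (fun t => f t z) hc
      simpa [Fintype.sum_sum_type] using this
    rintro (i | i)
    · simpa [huw, hww] using h1 (w i)
    · simpa [huu, hwu] using h1 (u i)
  refine ⟨Basis.mk hli (by rw [Set.Sum.elim_range, hsp]), ?_⟩
  ext (i | i) (j | j) <;>
    simp [Matrix.J, huu, hww, huw, hwu, Matrix.one_apply]

variable [IsDomain R] [IsPrincipalIdealRing R]

/-- A perfect alternating form over a principal ideal domain is a sum of hyperbolic planes. -/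
theorem exists_symplectic_families (n : ℕ) :
    ∀ (M : Type u) [AddCommGroup M] [Module R M] [Module.Finite R M] [Module.Free R M]
      (f : LinearMap.BilinForm R M), f.IsAlt → Function.Bijective f → finrank R M = n →
      ∃ (m : ℕ) (u w : Fin m → M), (∀ i j, f (u i) (u j) = 0) ∧ (∀ i j, f (w i) (w j) = 0) ∧
        (∀ i j, f (w i) (u j) = if i = j then 1 else 0) ∧
        Submodule.span R (Set.range u ∪ Set.range w) = ⊤ := by
  induction n using Nat.strong_induction_on with
  | _ n ih =>
  intro M _ _ _ _ f hf hbij hn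
  rcases Nat.eq_zero_or_pos n with rfl | hpos
  · have : Subsingleton M := Module.finrank_zero_iff.1 hn
    exact ⟨0, ![], ![], fun i => i.elim0, fun i => i.elim0, fun i => i.elim0,
      Subsingleton.elim _ _⟩
  let b := Module.finBasisOfFinrankEq R M hn
  let x : M := b ⟨0, hpos⟩
  -- Perfectness represents the first coordinate by y, so x and y span a hyperbolic plane; N is its
  -- orthogonal complement and q₀ the projection onto N.
  obtain ⟨y, hy⟩ := hbij.2 (b.coord ⟨0, hpos⟩)
  have hyx : f y x = 1 := by rw [hy]; simp [x]
  have hxy : f x y = -1 := by rw [← hf.neg_eq y x, hyx]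
  have hxx : f x x = 0 := hf x
  have hyy : f y y = 0 := hf y
  let N : Submodule R M := LinearMap.ker (f x) ⊓ LinearMap.ker (f y)
  have hN : ∀ z, z ∈ N ↔ f x z = 0 ∧ f y z = 0 := fun z => Iff.rfl
  have hN' : ∀ z : N, f z x = 0 ∧ f z y = 0 := fun z =>
    ⟨by rw [← hf.neg_eq x z, ((hN z).1 z.2).1, neg_zero],
      by rw [← hf.neg_eq y z, ((hN z).1 z.2).2, neg_zero]⟩
  let q₀ : M →ₗ[R] M := LinearMap.id - (f y).smulRight x + (f x).smulRight y
  have hq₀ : ∀ z, q₀ z = z - f y z • x + f x z • y := fun z => rfl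
  have hq₀N : ∀ z, q₀ z ∈ N := by
    intro z
    rw [hN, hq₀]
    simp [hxx, hyy, hxy, hyx]
  let q : M →ₗ[R] N := q₀.codRestrict N hq₀N
  have hq : ∀ z, (q z : M) = z - f y z • x + f x z • y := fun z => rfl
  have hfin : finrank R N < n := by
    -- Adding only the line through x already shows that the rank drops, which is all the induction
    -- needs.
    let j : R × N →ₗ[R] M := (LinearMap.toSpanSingleton R M x).coprod N.subtype
    have hj : Function.Injective j := by
      rw [injective_iff_map_eq_zero]
      rintro ⟨c, z⟩ h
      replace h : c • x + (z : M) = 0 := by simpa [j] using h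
      have hc : c = 0 := by
        have := congrArg (f y) h
        simpa [hyx, ((hN z).1 z.2).2] using this
      subst hc
      simpa using h
    have := LinearMap.finrank_le_finrank_of_injective hj
    rw [Module.finrank_prod, Module.finrank_self, hn] at this
    omega
  have hbijN : Function.Bijective (f.restrict N) := by
    constructor
    · rw [injective_iff_map_eq_zero]
      intro v hv
      apply Subtype.ext
      apply hbij.1
      rw [Submodule.coe_zero, map_zero]
      ext z
      have h1 : f v (q z) = 0 := LinearMap.congr_fun hv (q z)
      rw [hq] at h1
      simpa [(hN' v).1, (hN' v).2] using h1
    · intro φ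
      obtain ⟨v, hv⟩ := hbij.2 (φ ∘ₗ q)
      have hvq : ∀ z, f v z = φ (q z) := fun z => LinearMap.congr_fun hv z
      have hqx : q x = 0 := Subtype.ext (by rw [hq]; simp [hxx, hyx])
      have hqy : q y = 0 := Subtype.ext (by rw [hq]; simp [hyy, hxy])
      have hvN : v ∈ N := by
        rw [hN, ← hf.neg_eq v x, ← hf.neg_eq v y, hvq, hvq, hqx, hqy]
        simp
      refine ⟨⟨v, hvN⟩, LinearMap.ext fun z => ?_⟩
      change f v z = φ z
      rw [hvq]
      congr 1
      exact Subtype.ext (by rw [hq, ((hN z).1 z.2).1, ((hN z).1 z.2).2]; simp)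
  have hNfree : Module.Free R N := inferInstance
  obtain ⟨m, u, w, huu, hww, hwu, hsp⟩ := ih _ hfin N (f.restrict N) (fun z => hf z) hbijN rfl
  replace huu : ∀ i j, f (u i) (u j) = 0 := huu
  replace hww : ∀ i j, f (w i) (w j) = 0 := hww
  replace hwu : ∀ i j, f (w i) (u j) = if i = j then 1 else 0 := hwu
  refine ⟨m + 1, Fin.cons x fun i => u i, Fin.cons y fun i => w i, ?_, ?_, ?_, ?_⟩
  · refine Fin.cases (Fin.cases ?_ fun j => ?_) fun i => Fin.cases ?_ fun j => ?_
    · simpa using hxx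
    · simpa using ((hN _).1 (u j).2).1
    · simpa using (hN' (u i)).1
    · simpa using huu i j
  · refine Fin.cases (Fin.cases ?_ fun j => ?_) fun i => Fin.cases ?_ fun j => ?_
    · simpa using hyy
    · simpa using ((hN _).1 (w j).2).2
    · simpa using (hN' (w i)).2
    · simpa using hww i j
  · refine Fin.cases (Fin.cases ?_ fun j => ?_) fun i => Fin.cases ?_ fun j => ?_
    · simpa using hyx
    · simpa [(Fin.succ_ne_zero j).symm] using ((hN _).1 (u j).2).2
    · simpa using (hN' (w i)).1
    · simpa using hwu i j
  · rw [eq_top_iff]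
    intro z _
    set S := Submodule.span R (Set.range (Fin.cons x fun i => (u i : M) : Fin (m + 1) → M) ∪
      Set.range (Fin.cons y fun i => (w i : M) : Fin (m + 1) → M)) with hS
    have hxS : x ∈ S := Submodule.subset_span (Or.inl ⟨0, rfl⟩)
    have hyS : y ∈ S := Submodule.subset_span (Or.inr ⟨0, rfl⟩)
    have hNS : (⊤ : Submodule R N) ≤ S.comap N.subtype := by
      rw [← hsp, Submodule.span_le]
      rintro _ (⟨i, rfl⟩ | ⟨i, rfl⟩)
      · exact Submodule.subset_span (Or.inl ⟨i.succ, rfl⟩)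
      · exact Submodule.subset_span (Or.inr ⟨i.succ, rfl⟩)
    have hz : z = (q z : M) + f y z • x - f x z • y := by rw [hq]; abel
    rw [hz]
    exact sub_mem (add_mem (hNS (Submodule.mem_top (x := q z))) (S.smul_mem _ hxS))
      (S.smul_mem _ hyS)

/-- A perfect alternating form over a principal ideal domain has a symplectic basis. -/
theorem LinearMap.BilinForm.IsAlt.exists_basis_toMatrix_eq_J {M : Type*} [AddCommGroup M]
    [Module R M] [Module.Finite R M] [Module.Free R M] {f : LinearMap.BilinForm R M}
    (hf : f.IsAlt) (hbij : Function.Bijective f) {d : ℕ} (hd : finrank R M = 2 * d) :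
    ∃ b : Basis (Fin d ⊕ Fin d) R M, LinearMap.BilinForm.toMatrix b f = Matrix.J (Fin d) R := by
  obtain ⟨m, u, w, huu, hww, hwu, hsp⟩ := exists_symplectic_families _ M f hf hbij rfl
  obtain ⟨b, hb⟩ := _root_.exists_basis_toMatrix_eq_J f hf u w huu hww hwu hsp
  have hm : finrank R M = m + m := by simpa using Module.finrank_eq_card_basis b
  obtain rfl : m = d := by omega
  exact ⟨b, hb⟩

end SymplecticBasis

/-! ### From self-dual lattices to perfect integral forms -/

section IntegralForm

variable {𝒪 K V : Type*} [CommRing 𝒪] [Field K] [Algebra 𝒪 K] [IsFractionRing 𝒪 K]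
  [AddCommGroup V] [Module K V] [Module 𝒪 V] [IsScalarTower 𝒪 K V]

theorem Module.Basis.extendOfIsLattice_repr {ι : Type*} [Fintype ι] {T : Submodule 𝒪 V}
    [Submodule.IsLattice K T] (b : Basis ι 𝒪 T) (t : T) (i : ι) :
    (b.extendOfIsLattice K).repr (t : V) i = algebraMap 𝒪 K (b.repr t i) := by
  classical
  have h : (t : V) = ∑ j, algebraMap 𝒪 K (b.repr t j) • b.extendOfIsLattice K j := by
    have h' := congrArg T.subtype (b.sum_repr t)
    rw [map_sum] at h'
    simp only [Basis.extendOfIsLattice_apply, algebraMap_smul]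
    exact h'.symm
  rw [h, Basis.repr_sum_self]

variable [IsDomain 𝒪] [IsPrincipalIdealRing 𝒪]

/-- A form on a vector space restricts to a perfect form on a lattice that is its own dual. -/
theorem LinearMap.BilinForm.exists_isPerfPair_of_dualSubmodule_eq [FiniteDimensional K V]
    {f : LinearMap.BilinForm K V}
    (hf : f.Nondegenerate) (T : Submodule 𝒪 V) [Submodule.IsLattice K T]
    (h : f.dualSubmodule T = T) :
    ∃ f' : LinearMap.BilinForm 𝒪 T, f'.IsPerfPair ∧
      ∀ x y : T, algebraMap 𝒪 K (f' x y) = f x y := by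
  have : IsTorsionFree 𝒪 K := inferInstance
  have : Module.Free 𝒪 T := Submodule.IsLattice.free K T
  have : Module.Finite 𝒪 T := Module.Finite.of_fg (Submodule.IsLattice.fg (A := K))
  let f' : LinearMap.BilinForm 𝒪 T := f.dualSubmoduleToDual T ∘ₗ Submodule.inclusion h.ge
  have hf' : ∀ x y : T, algebraMap 𝒪 K (f' x y) = f x y := fun x y =>
    f.dualSubmoduleParing_spec (Submodule.inclusion h.ge x) y
  refine ⟨f', LinearMap.IsPerfPair.of_bijective _ ⟨?_, fun φ => ?_⟩, hf'⟩
  · exact (f.dualSubmoduleToDual_injective hf T Submodule.IsLattice.span_eq_top).comp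
      (Submodule.inclusion_injective _)
  · let b := Module.Free.chooseBasis 𝒪 T
    -- Surjectivity: extend φ to V and represent it by a vector v using f. Integrality of φ on T
    -- places v in the dual of T, which is T.
    let φK : V →ₗ[K] K := (b.extendOfIsLattice K).constr K fun i => algebraMap 𝒪 K (φ (b i))
    let v : V := (f.toDual hf).symm φK
    have hv : ∀ t : T, f v t = algebraMap 𝒪 K (φ t) := by
      have h1 : ((f v).restrictScalars 𝒪) ∘ₗ T.subtype = (Algebra.linearMap 𝒪 K) ∘ₗ φ := by
        refine b.ext fun i => ?_
        change f v (b i : V) = algebraMap 𝒪 K (φ (b i))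
        rw [LinearMap.BilinForm.apply_toDual_symm_apply, ← b.extendOfIsLattice_apply K,
          Basis.constr_basis]
      exact fun t => LinearMap.congr_fun h1 t
    have hvT : v ∈ T := h.le fun t ht => Submodule.mem_one.2 ⟨_, (hv ⟨t, ht⟩).symm⟩
    refine ⟨⟨v, hvT⟩, LinearMap.ext fun t => IsFractionRing.injective 𝒪 K ?_⟩
    rw [hf', hv]

end IntegralForm

/-! ### The main theorem: lattice form and matrix form -/

theorem theorem4p3
    (p ℓ : ℕ) (hp : p.Prime) (hℓ : ℓ.Prime) (hℓp : ℓ ≠ p)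
    {G : Type*} [Group G] (hG : IsOfInertiaType p G)
    -- `K` is a complete discrete valuation field with valuation ring `𝒪`
    {𝒪 K : Type*} [CommRing 𝒪] [IsDomain 𝒪] [IsDiscreteValuationRing 𝒪]
    [IsAdicComplete (IsLocalRing.maximalIdeal 𝒪) 𝒪]
    [Field K] [Algebra 𝒪 K] [IsFractionRing 𝒪 K]
    [CharZero K] [CharP (IsLocalRing.ResidueField 𝒪) ℓ]
    (e : ℕ) (he : IsDiscreteValuationRing.addVal 𝒪 (ℓ : 𝒪) = (e : ℕ∞))
    {V : Type*} [AddCommGroup V] [Module K V] [Module 𝒪 V] [IsScalarTower 𝒪 K V]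
    [FiniteDimensional K V] (d : ℕ) (hd : Module.finrank K V = 2 * d)
    (ρ : Representation K G V) (hρ : ρ.IsSymplectic) (hde : d * e + 1 < ℓ) :
    (∃ (T : Submodule 𝒪 V) (hT : ∀ (g : G), ∀ x ∈ T, ρ g x ∈ T),
      Submodule.IsLattice K T ∧
      ∃ f' : LinearMap.BilinForm 𝒪 T, f'.IsPerfPair ∧ f'.IsAlt ∧
        ∀ (g : G) (x y : T),
          f' ⟨ρ g x, hT g x x.2⟩ ⟨ρ g y, hT g y y.2⟩ = f' x y) ∧
    (∀ b : Module.Basis (Fin d ⊕ Fin d) K V,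
      ∃ P : Matrix.GeneralLinearGroup (Fin d ⊕ Fin d) K, ∀ g : G,
        ∃ A ∈ Matrix.symplecticGroup (Fin d) 𝒪,
          P.1 * LinearMap.toMatrix b b (ρ g) * P⁻¹.1 = A.map (algebraMap 𝒪 K)) := by
  obtain ⟨_, H, _, hH, hcyc, -⟩ := hG
  obtain ⟨f₀, hnd₀, halt₀, hinv₀⟩ := hρ
  -- ℓ vanishes in the residue field, so it is not a unit of 𝒪.
  have he1 : 1 ≤ e := by
    by_contra! h0
    obtain rfl : e = 0 := by omega
    have hu : IsUnit (ℓ : 𝒪) := by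
      rw [← IsDiscreteValuationRing.addVal_eq_zero_iff]
      simpa using he
    have := hu.map (IsLocalRing.residue 𝒪)
    rw [map_natCast, CharP.cast_eq_zero] at this
    exact not_isUnit_zero this
  have hsmall : finrank K V * e < 2 * (ℓ - 1) := by
    rw [hd, mul_assoc]
    omega
  obtain ⟨f, T, hf, hT, hle⟩ :=
    Representation.IsSymplecticForm.hasSelfDualLattice (𝒪 := 𝒪) hp hℓ hℓp H hH hcyc
      he he1 _ V ρ f₀ ⟨hnd₀, halt₀, hinv₀⟩ rfl hsmall
  have hlat := hT.isLattice
  have hinj := IsFractionRing.injective 𝒪 K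
  obtain ⟨f', hperf, hf'⟩ := LinearMap.BilinForm.exists_isPerfPair_of_dualSubmodule_eq
    hf.nondegenerate T (le_antisymm hle hT.le_dual)
  have halt : f'.IsAlt := fun x => hinj (by rw [hf', hf.isAlt, map_zero])
  have hinv : ∀ (g : G) (x y : T),
      f' ⟨ρ g x, hT.stable g x x.2⟩ ⟨ρ g y, hT.stable g y y.2⟩ = f' x y := fun g x y =>
    hinj (by rw [hf', hf']; exact hf.invariant g x y)
  refine ⟨⟨T, hT.stable, hlat, f', hperf, halt, hinv⟩, fun b => ?_⟩
  have : Module.Free 𝒪 T := Submodule.IsLattice.free K T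
  have : Module.Finite 𝒪 T := Module.Finite.of_fg (Submodule.IsLattice.fg (A := K))
  have hrank : finrank 𝒪 T = 2 * d := by
    rw [← hd, finrank, finrank, Submodule.IsLattice.rank' K T]
  obtain ⟨c, hc⟩ := halt.exists_basis_toMatrix_eq_J hperf.bijective_left hrank
  let cK := c.extendOfIsLattice K
  -- P changes coordinates from b to a symplectic 𝒪-basis of T. In that basis g has an integral
  -- matrix, which preserves J because f' is invariant.
  refine ⟨⟨cK.toMatrix b, b.toMatrix cK, cK.toMatrix_mul_toMatrix_flip b,
    b.toMatrix_mul_toMatrix_flip cK⟩, fun g => ?_⟩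
  let r : T →ₗ[𝒪] T := ((ρ g).restrictScalars 𝒪).restrict (hT.stable g)
  refine ⟨LinearMap.toMatrix c c r, ?_, ?_⟩
  · have hr : f'.comp r r = f' := LinearMap.ext₂ fun x y => hinv g x y
    rw [SymplecticGroup.mem_iff', ← hc, ← LinearMap.BilinForm.toMatrix_comp, hr]
  · change cK.toMatrix b * LinearMap.toMatrix b b (ρ g) * b.toMatrix cK = _
    rw [basis_toMatrix_mul_linearMap_toMatrix_mul_basis_toMatrix]
    ext i j
    rw [Matrix.map_apply, LinearMap.toMatrix_apply, LinearMap.toMatrix_apply,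
      ← Basis.extendOfIsLattice_repr (K := K), Basis.extendOfIsLattice_apply]
    rfl
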